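/- Let $\beta>1$ and let $p=p(N)\in(0,1]$ satisfy $p^3N\to\infty$ as $N\to\infty$. For each $N$ let $(\varepsilon_{i,j})_{i,j=1}^N=(\varepsilon^N_{i,j})_{i,j=1}^N$ be i.i.d. random variables with $\mathbb P[\varepsilon_{i,j}=1]=p$ and $\mathbb P[\varepsilon_{i,j}=0]=1-p$ (the edge indicators of a directed Erdős–Rényi graph on $\{1,\dots,N\}$ with loops admitted). For $\sigma\in\{-1,+1\}^N$ put $$H(\sigma)=-\frac1{2Np}\sum_{i,j=1}^N\varepsilon_{i,j}\sigma_i\sigma_j,\qquad Z_N(\beta)=\sum_{\sigma\in\{-1,+1\}^N}e^{-\beta H(\sigma)}$$ (no external field, $h=0$). Let $m^+(\beta)$ be the largest real solution of $z=\tanh(\beta z)$, let $m^-(\beta)=-m^+(\beta)$, and let $$\sigma^2(\beta)=\frac{1-m^+(\beta)^2}{1-\beta(1-m^+(\beta)^2)}.$$ Let $\mathcal M(\mathbb R)$ be the set of finite measures on $\mathbb R$ with the topology of weak convergence, and define the random elements of $\mathcal M(\mathbb R)$ $$L_N^+=\frac2{Z_N(\beta)}\sum_{\sigma\in\{-1,+1\}^N}e^{-\beta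 H(\sigma)}\,\delta_{\frac1{\sqrt N}\left(\sum_{i=1}^N\sigma_i-Nm^+(\beta)\right)}\,\mathbf 1_{\sum_{i=1}^N\sigma_i>0},$$ $$L_N^-=\frac2{Z_N(\beta)}\sum_{\sigma\in\{-1,+1\}^N}e^{-\beta H(\sigma)}\,\delta_{\frac1{\sqrt N}\left(\sum_{i=1}^N\sigma_i-Nm^-(\beta)\right)}\,\mathbf 1_{\sum_{i=1}^N\sigma_i\le0}.$$ Then both $L_N^+$ and $L_N^-$ converge in probability to the centered normal distribution $\mathfrak N_{0,\sigma^2(\beta)}$, considered as a deterministic element of $\mathcal M(\mathbb R)$. That is, for every metric $\rho$ on $\mathcal M(\mathbb R)$ generating the weak topology and every $\delta>0$, $$\lim_{N\to\infty}\mathbb P\left[\rho\left(L_N^+,\mathfrak N_{0,\sigma^2(\beta)}\right)>\delta\right]=0\qquad\text{and}\qquad\lim_{N\to\infty}\mathbb P\left[\rho\left(L_N^-,\mathfrak N_{0,\sigma^2(\beta)}\right)>\delta\right]=0.$$ -/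

import Mathlib

open MeasureTheory ProbabilityTheory Filter Topology

namespace DiluteCurieWeiss

noncomputable section

/-- `ε` is the family of edge indicators of the directed Erdős–Rényi graph `G(N, q)`, loops
admitted: the `ε i j`, for `i, j` in the vertex set, are independent, equal to `1` with
probability `q` and to `0` with probability `1 - q`. -/
structure IsDirectedErdosRenyi {Ω : Type*} [MeasurableSpace Ω] (P : Measure Ω) {N : ℕ} (q : ℝ)
    (ε : Fin N → Fin N → Ω → ℝ) : Prop where
  measurable : ∀ i j, Measurable (ε i j)
  indep : iIndepFun (fun e : Fin N × Fin N => ε e.1 e.2) P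
  prob_one : ∀ i j, P {ω | ε i j ω = 1} = ENNReal.ofReal q
  prob_zero : ∀ i j, P {ω | ε i j ω = 0} = ENNReal.ofReal (1 - q)

/-- Spin configurations, elements of `{-1, +1}^N`. -/
abbrev Config (N : ℕ) : Type := Fin N → ℤˣ

/-- The spin `σ_i ∈ {-1, +1}` as a real number. -/
def spin {N : ℕ} (σ : Config N) (i : Fin N) : ℝ := ((σ i : ℤ) : ℝ)

/-- The total magnetization `|σ| = ∑ i, σ_i`. -/
def totalSpin {N : ℕ} (σ : Config N) : ℝ := ∑ i, spin σ i

/-- The Hamiltonian `H(σ)` for edge probability `q`, external field `h` and a fixed realization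
`e` of the edge indicators. -/
def hamiltonian {N : ℕ} (q h : ℝ) (e : Fin N → Fin N → ℝ) (σ : Config N) : ℝ :=
  -(1 / (2 * (N : ℝ) * q)) * (∑ i, ∑ j, e i j * spin σ i * spin σ j) - h * totalSpin σ

/-- The partition function `Z_N(β)`. -/
def partitionFunction {N : ℕ} (β q h : ℝ) (e : Fin N → Fin N → ℝ) : ℝ :=
  ∑ σ : Config N, Real.exp (-β * hamiltonian q h e σ)

/-- The Gibbs probability `μ_β(σ)`. -/
def gibbs {N : ℕ} (β q h : ℝ) (e : Fin N → Fin N → ℝ) (σ : Config N) : ℝ :=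
  Real.exp (-β * hamiltonian q h e σ) / partitionFunction β q h e

/-- `m⁺(β)`, the largest solution of `z = tanh (β z)`; see `isGreatest_mPlus`. -/
def mPlus (β : ℝ) : ℝ := sSup {z : ℝ | z = Real.tanh (β * z)}

/-- `m⁻(β) = -m⁺(β)`. -/
def mMinus (β : ℝ) : ℝ := -mPlus β

/-- The variance `σ²(β) = (1 - m⁺(β)²) / (1 - β (1 - m⁺(β)²))`; see `variance_pos`. -/
def variance (β : ℝ) : ℝ := (1 - mPlus β ^ 2) / (1 - β * (1 - mPlus β ^ 2))

/-- The point mass at `x` as a finite measure. -/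
def diracFM (x : ℝ) : FiniteMeasure ℝ := ⟨Measure.dirac x, inferInstance⟩

/-- The centered normal law with variance `v > 0` as a finite measure. -/
def normalFM (v : ℝ) : FiniteMeasure ℝ := ⟨gaussianReal 0 v.toNNReal, inferInstance⟩

/-- `L_N⁺` (with `h = 0`) for a fixed realization `e` of the edge indicators: twice the law of
`(|σ| - N m⁺(β)) / √N` under the Gibbs measure, restricted to the configurations with `|σ| > 0`. -/
def LPlus {N : ℕ} (β q : ℝ) (e : Fin N → Fin N → ℝ) : FiniteMeasure ℝ :=
  ∑ σ : Config N with 0 < totalSpin σ,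
    (2 * gibbs β q 0 e σ).toNNReal • diracFM ((totalSpin σ - N * mPlus β) / √(N : ℝ))

/-- `L_N⁻` (with `h = 0`) for a fixed realization `e` of the edge indicators: twice the law of
`(|σ| - N m⁻(β)) / √N` under the Gibbs measure, restricted to the configurations with `|σ| ≤ 0`. -/
def LMinus {N : ℕ} (β q : ℝ) (e : Fin N → Fin N → ℝ) : FiniteMeasure ℝ :=
  ∑ σ : Config N with totalSpin σ ≤ 0,
    (2 * gibbs β q 0 e σ).toNNReal • diracFM ((totalSpin σ - N * mMinus β) / √(N : ℝ))

/-- The metric `ρ` on the finite measures on `ℝ` generates the weak topology, that is, the topology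
of convergence of the integrals of all bounded continuous functions. -/
def GeneratesWeakTopology (ρ : MetricSpace (FiniteMeasure ℝ)) : Prop :=
  ρ.toPseudoMetricSpace.toUniformSpace.toTopologicalSpace =
    FiniteMeasure.instTopologicalSpace

/-- Convergence in probability of the random finite measures `L N`, defined on the probability
spaces `(Ω N, P N)`, to the deterministic finite measure `ν`, with respect to the metric `ρ`. -/
def ConvergesInProbability (ρ : MetricSpace (FiniteMeasure ℝ)) {Ω : ℕ → Type*}
    [∀ N, MeasurableSpace (Ω N)] (P : ∀ N, Measure (Ω N))
    (L : ∀ N, Ω N → FiniteMeasure ℝ) (ν : FiniteMeasure ℝ) : Prop :=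
  ∀ δ : ℝ, 0 < δ → Tendsto (fun N => P N {ω | δ < ρ.dist (L N ω) ν}) atTop (𝓝 0)

theorem isGreatest_mPlus (β : ℝ) : IsGreatest {z : ℝ | z = Real.tanh (β * z)} (mPlus β) := by
  have hc : Continuous Real.tanh := by
    have : Real.tanh = fun x => Real.sinh x / Real.cosh x :=
      funext fun x => Real.tanh_eq_sinh_div_cosh x
    rw [this]
    exact Real.continuous_sinh.div Real.continuous_cosh fun x => (Real.cosh_pos x).ne'
  have hcl : IsClosed {z : ℝ | z = Real.tanh (β * z)} :=
    isClosed_eq continuous_id (hc.comp (continuous_const.mul continuous_id))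
  have hne : ({z : ℝ | z = Real.tanh (β * z)}).Nonempty := ⟨0, by simp⟩
  have hb : BddAbove {z : ℝ | z = Real.tanh (β * z)} :=
    ⟨1, fun z hz => by rw [hz]; exact (Real.tanh_lt_one _).le⟩
  exact ⟨hcl.csSup_mem hne hb, fun z hz => le_csSup hb hz⟩

theorem mPlus_pos {β : ℝ} (hβ : 1 < β) : 0 < mPlus β := by
  have hc : Continuous fun z : ℝ => Real.sinh (β * z) - z * Real.cosh (β * z) := by fun_prop
  have hd : HasDerivAt (fun z : ℝ => Real.sinh (β * z) - z * Real.cosh (β * z)) (β - 1) 0 := by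
    have h1 : HasDerivAt (fun z : ℝ => β * z) β 0 := by
      simpa using (hasDerivAt_id (0 : ℝ)).const_mul β
    exact (h1.sinh.sub ((hasDerivAt_id (0 : ℝ)).mul h1.cosh)).congr_deriv (by simp)
  have hpos : ∀ᶠ z in 𝓝[>] (0 : ℝ), 0 < Real.sinh (β * z) - z * Real.cosh (β * z) := by
    have h := (hasDerivAt_iff_tendsto_slope.1 hd).mono_left
      (nhdsWithin_mono 0 (fun z (hz : 0 < z) => ne_of_gt hz))
    filter_upwards [h.eventually (lt_mem_nhds (sub_pos.2 hβ)), self_mem_nhdsWithin] with z hz hz0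
    have hz0' : (0 : ℝ) < z := hz0
    simp only [slope_def_field, sub_zero, mul_zero, Real.sinh_zero, zero_mul] at hz
    exact (div_pos_iff_of_pos_right hz0').1 hz
  obtain ⟨a, ha, ha1, ha0⟩ := (hpos.and ((eventually_nhdsWithin_of_eventually_nhds
    (gt_mem_nhds one_pos)).and self_mem_nhdsWithin)).exists
  have ha0' : (0 : ℝ) < a := ha0
  have h1 : Real.sinh (β * 1) - 1 * Real.cosh (β * 1) ≤ 0 := by
    have := Real.sinh_lt_cosh (β * 1)
    linarith
  obtain ⟨z, hz, hz0⟩ := intermediate_value_Icc' ha1.le hc.continuousOn ⟨h1, ha.le⟩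
  have hz' : z = Real.tanh (β * z) := by
    rw [Real.tanh_eq_sinh_div_cosh, eq_div_iff (Real.cosh_pos _).ne']
    simp only at hz0
    linarith
  exact ha0'.trans_le (hz.1.trans ((isGreatest_mPlus β).2 hz'))

theorem variance_pos {β : ℝ} (hβ : 1 < β) : 0 < variance β := by
  have hm := mPlus_pos hβ
  have he : mPlus β = Real.tanh (β * mPlus β) := (isGreatest_mPlus β).1
  set m := mPlus β with hmdef
  have hx : 0 < β * m := by positivity
  have hC := Real.cosh_pos (β * m)
  have hS := Real.self_lt_sinh_iff.2 hx
  have h1 := Real.one_le_cosh (β * m)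
  have hsq := Real.cosh_sq (β * m)
  have hmC : m * Real.cosh (β * m) = Real.sinh (β * m) := by
    have := Real.tanh_eq_sinh_div_cosh (β * m)
    rw [← he] at this
    exact (eq_div_iff hC.ne').1 this
  have hone : (1 - m ^ 2) * Real.cosh (β * m) ^ 2 = 1 := by
    have : m ^ 2 * Real.cosh (β * m) ^ 2 = Real.sinh (β * m) ^ 2 := by rw [← hmC]; ring
    linarith
  have hnum : 0 < 1 - m ^ 2 := by
    by_contra! h
    nlinarith [pow_pos hC 2]
  have hden : 0 < 1 - β * (1 - m ^ 2) := by
    have hlt : β * m < m * Real.cosh (β * m) ^ 2 := by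
      have : m * Real.cosh (β * m) ^ 2 = Real.sinh (β * m) * Real.cosh (β * m) := by
        rw [← hmC]; ring
      nlinarith
    have hlt' : β < Real.cosh (β * m) ^ 2 := by nlinarith
    nlinarith
  exact div_pos hnum hden

end

end DiluteCurieWeiss

namespace DiluteCurieWeiss

noncomputable section

/-! The random Gibbs measure is compared with that of the Curie–Weiss model, with weights `u σ = exp
(β M² / (2N))` and `M = totalSpin σ`, by a second moment argument. Replacing `σ_i σ_j` by `σ_i σ_j -
m²`, with `m = mPlus β`, multiplies every Boltzmann weight by the same function of the edges and
leaves the Gibbs measure unchanged (`gibbs_eq`). It also removes the effect of the fluctuating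
number of edges, which would otherwise put a correction of order `1/q` into the exponent of the
mixed second moments.

By independence of the edges, the expectations of `W σ` and `W σ * W τ` for the centred weights `W`
are products of Bernoulli exponential moments, expanded to third order. The first order gives `u`.
The second order is a common constant plus terms `M² - m² N²` and `R² - m⁴ N²`, where `R` is the
overlap; under the Curie–Weiss measure both are of order `N^(3/2)`, so their contribution is of
order `1 / (q √N)`. The third order contributes `1 / (q √N)²`. The growth of `p³ N` thus enters
through `p² N → ∞`. Exponential moments of `M` and `R` on the scale `√N` make these estimates
summable (`exists_moments_le`), and Chebyshev's inequality for numerator and denominator carries any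
Curie–Weiss limit over to the diluted model (`prob_weightedMean_le`,
`convergesInProbability_of_curieWeiss`).

The Curie–Weiss side rests on the Hubbard–Stratonovich transformation: a Gaussian auxiliary variable
`x` makes the spins independent with mean `tanh (β x)`, and summing them out leaves the density `exp
(N * pressure β x)`, with maxima at `± m`. A global quadratic bound on the pressure
(`exists_pressure_le`) gives the exponential moments and dominates the Laplace integral. Near `m`,
`√N (x - m)` is asymptotically normal with variance `1 / curvature β`; given the spins it is the
magnetization fluctuation plus independent Gaussian noise of variance `1 / β`. Removing the noise
leaves `variance β` (`variance_eq`, `tendsto_sum_fourier`). The half line `x > 0` stands for the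
phase `M > 0` up to an exponentially small error, because `pressure β m > 0`. The other phase
follows by spin flip. -/

/-! ### Convergence in probability through test functions -/

/-- The sets which contain the random points `L N` with probability tending to one. -/
def inProbabilityFilter {E : Type*} {Ω : ℕ → Type*} [∀ N, MeasurableSpace (Ω N)]
    (P : ∀ N, Measure (Ω N)) (L : ∀ N, Ω N → E) : Filter E where
  sets := {s | Tendsto (fun N => P N {ω | L N ω ∉ s}) atTop (𝓝 0)}
  univ_sets := by simp
  sets_of_superset {s t} hs hst := by
    refine tendsto_of_tendsto_of_tendsto_of_le_of_le tendsto_const_nhds hs (fun _ => zero_le)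
      fun N => measure_mono fun ω hω h => hω (hst h)
  inter_sets {s t} hs ht := by
    have h := Tendsto.add hs ht
    rw [add_zero] at h
    refine tendsto_of_tendsto_of_tendsto_of_le_of_le tendsto_const_nhds h (fun _ => zero_le)
      fun N => (measure_mono fun ω hω => ?_).trans (measure_union_le _ _)
    by_cases h : L N ω ∈ s
    · exact Or.inr fun h' => hω ⟨h, h'⟩
    · exact Or.inl h

theorem mem_inProbabilityFilter {E : Type*} {Ω : ℕ → Type*} [∀ N, MeasurableSpace (Ω N)]
    {P : ∀ N, Measure (Ω N)} {L : ∀ N, Ω N → E} {s : Set E} :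
    s ∈ inProbabilityFilter P L ↔ Tendsto (fun N => P N {ω | L N ω ∉ s}) atTop (𝓝 0) :=
  Iff.rfl

/-- Convergence in probability of the integrals of all bounded continuous functions implies
convergence in probability for every metric that generates the weak topology. -/
theorem convergesInProbability_of_forall_integral {ρ : MetricSpace (FiniteMeasure ℝ)}
    (hρ : GeneratesWeakTopology ρ) {Ω : ℕ → Type*} [∀ N, MeasurableSpace (Ω N)]
    {P : ∀ N, Measure (Ω N)} {L : ∀ N, Ω N → FiniteMeasure ℝ} {ν : FiniteMeasure ℝ}
    (h : ∀ g : BoundedContinuousFunction ℝ ℝ, ∀ η : ℝ, 0 < η →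
      Tendsto (fun N => P N {ω | η ≤ |∫ x, g x ∂(L N ω : Measure ℝ) - ∫ x, g x ∂(ν : Measure ℝ)|})
        atTop (𝓝 0)) :
    ConvergesInProbability ρ P L ν := by
  -- Along this filter the hypothesis says that all test integrals of the identity converge, so the
  -- characterization of weak convergence applies directly: no countable family of test functions
  -- has to be chosen, and no measurability of `L N` is needed.
  have hle : Tendsto id (inProbabilityFilter P L) (𝓝 ν) := by
    refine FiniteMeasure.tendsto_iff_forall_integral_tendsto.2 fun g => ?_
    rw [Metric.tendsto_nhds]
    intro η hη
    have := h g η hη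
    refine mem_inProbabilityFilter.2 (this.congr fun N => ?_)
    simp [Real.dist_eq]
  intro δ hδ
  have hball : {μ | ρ.dist μ ν < δ} ∈ 𝓝 ν := by
    have h1 : {μ | ρ.dist μ ν < δ} ∈
        @nhds _ ρ.toPseudoMetricSpace.toUniformSpace.toTopologicalSpace ν :=
      @Metric.ball_mem_nhds _ ρ.toPseudoMetricSpace ν δ hδ
    rwa [hρ] at h1
  have := mem_inProbabilityFilter.1 (hle hball)
  refine tendsto_of_tendsto_of_tendsto_of_le_of_le tendsto_const_nhds this (fun _ => zero_le)
      fun N => measure_mono fun ω hω => ?_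
  simp only [Set.mem_ofPred_eq] at hω ⊢
  linarith

/-! ### Second moment method for ratios of weighted sums -/

/-- Convexity of `exp` along `ε * y = (1 - ε) * 0 + ε * y` extracts the small factor `ε` even when
`y` is large. An error `ε * y` in an exponent then costs `ε` times an exponential moment of `y`. -/
theorem abs_exp_sub_one_le {d ε y : ℝ} (hε : ε ≤ 1) (hε0 : 0 ≤ ε) (hd : |d| ≤ ε * y) :
    |Real.exp d - 1| ≤ ε * Real.exp y := by
  have h1 : |Real.exp d - 1| ≤ Real.exp |d| - 1 := by
    rw [abs_le]
    constructor
    · have h2 := Real.add_one_le_exp (-|d|)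
      have h3 := Real.add_one_le_exp (|d|)
      have h4 := Real.exp_le_exp.2 (neg_abs_le d)
      have h5 : Real.exp |d| + Real.exp (-|d|) ≥ 2 := by
        have := Real.one_le_cosh |d|
        rw [Real.cosh_eq] at this
        linarith
      linarith
    · have := Real.exp_le_exp.2 (le_abs_self d)
      linarith
  have h2 : Real.exp (ε * y) ≤ (1 - ε) + ε * Real.exp y := by
    have := convexOn_exp.2 (Set.mem_univ (0 : ℝ)) (Set.mem_univ y) (sub_nonneg.2 hε) hε0
      (by ring)
    simpa using this
  have h3 := Real.exp_le_exp.2 hd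
  linarith

/-- Mean square estimate for a weighted sum with random weights `W` whose first two moments are
close to those of the deterministic weights `κ u`. -/
theorem integral_sq_weightedSum_le {S Ω : Type*} [Fintype S] [MeasurableSpace Ω] (P : Measure Ω)
    [IsProbabilityMeasure P] (W : S → Ω → ℝ) (hW : ∀ σ, MemLp (W σ) 2 P)
    (u : S → ℝ) (κ ε B : ℝ) (hκ : 0 < κ) (hu : ∀ σ, 0 ≤ u σ)
    (h1 : ∑ σ, |∫ ω, W σ ω ∂P - κ * u σ| ≤ ε * (κ * ∑ σ, u σ))
    (h2 : ∑ σ, ∑ τ, |∫ ω, W σ ω * W τ ω ∂P - κ * u σ * (κ * u τ)| ≤ ε * (κ * ∑ σ, u σ) ^ 2)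
    (G : S → ℝ) (hG : ∀ σ, |G σ| ≤ B) :
    Integrable (fun ω => (∑ σ, W σ ω * G σ - κ * ∑ σ, u σ * G σ) ^ 2) P ∧
    ∫ ω, (∑ σ, W σ ω * G σ - κ * ∑ σ, u σ * G σ) ^ 2 ∂P
      ≤ 3 * B ^ 2 * ε * (κ * ∑ σ, u σ) ^ 2 := by
  set U := κ * ∑ σ, u σ with hU
  set A := κ * ∑ σ, u σ * G σ with hA
  have hWi : ∀ σ, Integrable (W σ) P := fun σ => (hW σ).integrable (by norm_num)
  have hWW : ∀ σ τ, Integrable (fun ω => W σ ω * W τ ω) P := fun σ τ =>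
    (hW σ).integrable_mul (hW τ)
  have hexp : ∀ ω, (∑ σ, W σ ω * G σ - A) ^ 2 =
      (∑ σ, ∑ τ, G σ * G τ * (W σ ω * W τ ω)) - 2 * A * (∑ σ, G σ * W σ ω) + A ^ 2 := by
    intro ω
    rw [sub_sq, sq (∑ σ, W σ ω * G σ), Finset.sum_mul_sum]
    congr 2
    · exact Finset.sum_congr rfl fun σ _ => Finset.sum_congr rfl fun τ _ => by ring
    · simp_rw [mul_comm (G _)]; ring
  have hi1 : Integrable (fun ω => ∑ σ, ∑ τ, G σ * G τ * (W σ ω * W τ ω)) P :=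
    integrable_finsetSum _ fun σ _ => integrable_finsetSum _ fun τ _ => (hWW σ τ).const_mul _
  have hi2 : Integrable (fun ω => 2 * A * (∑ σ, G σ * W σ ω)) P :=
    (integrable_finsetSum _ fun σ _ => (hWi σ).const_mul _).const_mul _
  simp_rw [hexp]
  refine ⟨(hi1.sub hi2).add (integrable_const _), ?_⟩
  have hi3 : Integrable (fun ω => (∑ σ, ∑ τ, G σ * G τ * (W σ ω * W τ ω)) -
      2 * A * (∑ σ, G σ * W σ ω)) P := hi1.sub hi2
  rw [integral_add hi3 (integrable_const _), integral_sub hi1 hi2,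
    integral_finsetSum _ (fun σ _ => integrable_finsetSum _ fun τ _ => (hWW σ τ).const_mul _),
    integral_const_mul, integral_finsetSum _ (fun σ _ => (hWi σ).const_mul _)]
  simp_rw [integral_finsetSum _ (fun τ _ => (hWW _ τ).const_mul _), integral_const_mul]
  have hA' : A = ∑ σ, G σ * (κ * u σ) := by
    rw [hA, Finset.mul_sum]; exact Finset.sum_congr rfl fun σ _ => by ring
  -- With `X` the random sum, `E (X - A)² = (E X² - A²) - 2 A (E X - A)`: only differences of
  -- moments remain. They contribute one and two units of the final factor `3`.
  have hsplit : (∑ σ, ∑ τ, G σ * G τ * ∫ ω, W σ ω * W τ ω ∂P) -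
      2 * A * (∑ σ, G σ * ∫ ω, W σ ω ∂P) + ∫ _, A ^ 2 ∂P =
      (∑ σ, ∑ τ, G σ * G τ * (∫ ω, W σ ω * W τ ω ∂P - κ * u σ * (κ * u τ))) -
      2 * A * (∑ σ, G σ * (∫ ω, W σ ω ∂P - κ * u σ)) := by
    have e1 : ∑ σ, ∑ τ, G σ * G τ * (κ * u σ * (κ * u τ)) = A * A := by
      rw [hA', Finset.sum_mul_sum]
      exact Finset.sum_congr rfl fun σ _ => Finset.sum_congr rfl fun τ _ => by ring
    simp only [mul_sub, Finset.sum_sub_distrib, e1, ← hA', integral_const, probReal_univ, one_smul]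
    ring
  rw [hsplit]
  -- A negative `B` is possible only when there are no weights at all.
  have hBnn : 0 ≤ B ∨ IsEmpty S := by
    by_cases hS : IsEmpty S
    · exact Or.inr hS
    · obtain ⟨σ⟩ := not_isEmpty_iff.1 hS
      exact Or.inl ((abs_nonneg _).trans (hG σ))
  rcases hBnn with hB | hS
  swap
  · simp [U]
  have hU0 : 0 ≤ U := mul_nonneg hκ.le (Finset.sum_nonneg fun σ _ => hu σ)
  have b1 : (∑ σ, ∑ τ, G σ * G τ * (∫ ω, W σ ω * W τ ω ∂P - κ * u σ * (κ * u τ)))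
      ≤ B ^ 2 * (ε * U ^ 2) := by
    refine le_trans ?_ (mul_le_mul_of_nonneg_left h2 (sq_nonneg B))
    simp only [Finset.mul_sum]
    refine Finset.sum_le_sum fun σ _ => Finset.sum_le_sum fun τ _ => ?_
    refine (le_abs_self _).trans ?_
    rw [abs_mul, abs_mul, sq]
    exact mul_le_mul_of_nonneg_right (mul_le_mul (hG σ) (hG τ) (abs_nonneg _) hB) (abs_nonneg _)
  have b2 : |∑ σ, G σ * (∫ ω, W σ ω ∂P - κ * u σ)| ≤ B * (ε * U) := by
    refine le_trans ?_ (mul_le_mul_of_nonneg_left h1 hB)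
    rw [Finset.mul_sum]
    refine (Finset.abs_sum_le_sum_abs _ _).trans (Finset.sum_le_sum fun σ _ => ?_)
    rw [abs_mul]
    exact mul_le_mul_of_nonneg_right (hG σ) (abs_nonneg _)
  have b3 : |A| ≤ B * U := by
    rw [hA', hU, Finset.mul_sum, Finset.mul_sum]
    refine (Finset.abs_sum_le_sum_abs _ _).trans (Finset.sum_le_sum fun σ _ => ?_)
    have := mul_nonneg hκ.le (hu σ)
    rw [abs_mul, abs_of_nonneg this]
    exact mul_le_mul_of_nonneg_right (hG σ) this
  have b4 : -(A * (∑ σ, G σ * (∫ ω, W σ ω ∂P - κ * u σ))) ≤ B * U * (B * (ε * U)) := by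
    refine (neg_le_abs _).trans ?_
    rw [abs_mul]
    exact mul_le_mul b3 b2 (abs_nonneg _) (mul_nonneg hB hU0)
  nlinarith

/-- Here `x / y - a = ((x - a U) - a (y - U)) / y`, and `η ≤ 1 / 2` keeps `y ≥ U / 2`, whence the
factor `2`. -/
theorem abs_div_sub_le {x y a η : ℝ} {U : ℝ} (hU : 0 < U) (hη : η ≤ 1 / 2)
    (hx : |x - a * U| ≤ η * U) (hy : |y - U| ≤ η * U) :
    |x / y - a| ≤ 2 * (1 + |a|) * η := by
  have hy' := abs_le.1 hy
  have hy0 : U / 2 ≤ y := by nlinarith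
  have hypos : 0 < y := by linarith
  have h1 : x / y - a = (x - a * y) / y := by field_simp
  rw [h1, abs_div, abs_of_pos hypos, div_le_iff₀ hypos]
  have h2 : |x - a * y| ≤ |x - a * U| + |a| * |y - U| := by
    rw [← abs_mul, show x - a * y = (x - a * U) - a * (y - U) by ring]
    exact abs_sub _ _
  have hη0 : 0 ≤ η := by
    have := (abs_nonneg _).trans hx
    by_contra! h
    nlinarith
  have h3 := mul_le_mul_of_nonneg_left hy (abs_nonneg a)
  have h4 : 0 ≤ (1 + |a|) * η := by positivity
  nlinarith

/-- Chebyshev's inequality for the ratio of two weighted sums with random weights. -/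
theorem prob_weightedMean_le {S Ω : Type*} [Fintype S] [MeasurableSpace Ω] (P : Measure Ω)
    [IsProbabilityMeasure P] (W : S → Ω → ℝ) (hW : ∀ σ, MemLp (W σ) 2 P)
    (u : S → ℝ) (κ ε B : ℝ) (hκ : 0 < κ) (hu : ∀ σ, 0 ≤ u σ) (hU : 0 < ∑ σ, u σ)
    (h1 : ∑ σ, |∫ ω, W σ ω ∂P - κ * u σ| ≤ ε * (κ * ∑ σ, u σ))
    (h2 : ∑ σ, ∑ τ, |∫ ω, W σ ω * W τ ω ∂P - κ * u σ * (κ * u τ)| ≤ ε * (κ * ∑ σ, u σ) ^ 2)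
    (G : S → ℝ) (hB : 1 ≤ B) (hG : ∀ σ, |G σ| ≤ B) (η : ℝ) (hη : 0 < η) (hη2 : η ≤ 1 / 2) :
    P {ω | 2 * (1 + B) * η < |(∑ σ, W σ ω * G σ) / (∑ σ, W σ ω) -
        (∑ σ, u σ * G σ) / ∑ σ, u σ|} ≤ ENNReal.ofReal (6 * B ^ 2 * ε / η ^ 2) := by
  set U := ∑ σ, u σ with hUdef
  have cheb : ∀ F : S → ℝ, (∀ σ, |F σ| ≤ B) →
      P {ω | η * (κ * U) ≤ |∑ σ, W σ ω * F σ - κ * ∑ σ, u σ * F σ|} ≤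
        ENNReal.ofReal (3 * B ^ 2 * ε / η ^ 2) := by
    intro F hF
    obtain ⟨hi, hle⟩ := integral_sq_weightedSum_le P W hW u κ ε B hκ hu h1 h2 F hF
    have hpos : 0 < η * (κ * U) := by positivity
    have hm := mul_meas_ge_le_integral_of_nonneg (μ := P)
      (f := fun ω => (∑ σ, W σ ω * F σ - κ * ∑ σ, u σ * F σ) ^ 2)
      (ae_of_all _ fun ω => sq_nonneg _) hi ((η * (κ * U)) ^ 2)
    have hset : {ω | η * (κ * U) ≤ |∑ σ, W σ ω * F σ - κ * ∑ σ, u σ * F σ|} =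
        {ω | (η * (κ * U)) ^ 2 ≤ (∑ σ, W σ ω * F σ - κ * ∑ σ, u σ * F σ) ^ 2} := by
      ext ω
      simp only [Set.mem_ofPred_eq]
      rw [sq_le_sq, abs_of_pos hpos]
    rw [hset]
    refine ENNReal.le_ofReal_iff_toReal_le (measure_ne_top _ _) ?_ |>.2 ?_
    · by_contra! h
      have h3 : 0 ≤ ε * (κ * U) := (Finset.sum_nonneg fun σ _ => abs_nonneg _).trans h1
      have h4 : 0 < κ * U := by positivity
      have h5 : 0 ≤ ε := by
        by_contra! h'
        nlinarith
      have : 0 ≤ 3 * B ^ 2 * ε / η ^ 2 := by positivity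
      linarith
    · rw [le_div_iff₀ (by positivity)]
      have h3 := hm.trans hle
      have h4 : 0 < (κ * U) ^ 2 := by positivity
      rw [measureReal_def] at h3
      refine le_of_mul_le_mul_right ?_ h4
      linarith
  have hsub : {ω | 2 * (1 + B) * η < |(∑ σ, W σ ω * G σ) / (∑ σ, W σ ω) -
        (∑ σ, u σ * G σ) / U|} ⊆
      {ω | η * (κ * U) ≤ |∑ σ, W σ ω * G σ - κ * ∑ σ, u σ * G σ|} ∪
      {ω | η * (κ * U) ≤ |∑ σ, W σ ω * 1 - κ * ∑ σ, u σ * 1|} := by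
    intro ω hω
    by_contra hc
    simp only [Set.mem_union, Set.mem_ofPred_eq, not_or, not_le, mul_one] at hc hω
    have ha : |(∑ σ, u σ * G σ) / U| ≤ B := by
      rw [abs_div, abs_of_pos hU, div_le_iff₀ hU, hUdef, Finset.mul_sum]
      refine (Finset.abs_sum_le_sum_abs _ _).trans (Finset.sum_le_sum fun σ _ => ?_)
      rw [abs_mul, abs_of_nonneg (hu σ), mul_comm]
      exact mul_le_mul_of_nonneg_right (hG σ) (hu σ)
    have := abs_div_sub_le (x := ∑ σ, W σ ω * G σ) (y := ∑ σ, W σ ω)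
      (a := (∑ σ, u σ * G σ) / U) (η := η) (U := κ * U) (by positivity) hη2
      (by
        have e : (∑ σ, u σ * G σ) / U * (κ * U) = κ * ∑ σ, u σ * G σ := by field_simp
        rw [e]; exact hc.1.le) hc.2.le
    nlinarith
  refine (measure_mono hsub).trans ((measure_union_le _ _).trans ?_)
  -- The denominator is the weighted sum of the constant `1`, which is an admissible function
  -- because `1 ≤ B`.
  refine (add_le_add (cheb G hG) (cheb (fun _ => 1) (fun _ => by simpa using hB))).trans ?_
  have hε : 0 ≤ 3 * B ^ 2 * ε / η ^ 2 := by
    have h3 : 0 ≤ ε * (κ * U) := (Finset.sum_nonneg fun σ _ => abs_nonneg _).trans h1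
    have h4 : 0 < κ * U := by positivity
    have h5 : 0 ≤ ε := by
      by_contra! h'
      nlinarith
    positivity
  rw [← ENNReal.ofReal_add hε hε]
  exact ENNReal.ofReal_le_ofReal (le_of_eq (by ring))

/-! ### Elementary properties of the hyperbolic tangent -/

theorem tendsto_sqrt_natCast : Tendsto (fun N : ℕ => √(N : ℝ)) atTop atTop :=
  Real.tendsto_sqrt_atTop.comp tendsto_natCast_atTop_atTop

theorem hasDerivAt_tanh (x : ℝ) : HasDerivAt Real.tanh (1 - Real.tanh x ^ 2) x := by
  have hC := (Real.cosh_pos x).ne'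
  have h := (Real.hasDerivAt_sinh x).div (Real.hasDerivAt_cosh x) hC
  have hf : Real.tanh = Real.sinh / Real.cosh := by
    ext y
    simp [Real.tanh_eq_sinh_div_cosh]
  rw [hf]
  refine h.congr_deriv ?_
  simp only [Pi.div_apply]
  field_simp

theorem continuous_tanh : Continuous Real.tanh :=
  continuous_iff_continuousAt.2 fun x => (hasDerivAt_tanh x).continuousAt

theorem deriv_tanh : deriv Real.tanh = fun x => 1 - Real.tanh x ^ 2 :=
  funext fun x => (hasDerivAt_tanh x).deriv

theorem monotone_tanh : Monotone Real.tanh :=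
  monotone_of_deriv_nonneg (fun x => (hasDerivAt_tanh x).differentiableAt) fun x => by
    rw [deriv_tanh]
    exact sub_nonneg.2 (Real.tanh_sq_lt_one x).le

theorem tanh_nonneg {x : ℝ} (hx : 0 ≤ x) : 0 ≤ Real.tanh x := by
  simpa using monotone_tanh hx

theorem abs_tanh_sub_le (x y : ℝ) : |Real.tanh x - Real.tanh y| ≤ |x - y| := by
  have := Convex.norm_image_sub_le_of_norm_deriv_le (f := Real.tanh) (C := 1) (s := Set.univ)
    (x := y) (y := x) (fun x _ => (hasDerivAt_tanh x).differentiableAt)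
    (fun x _ => by
      rw [deriv_tanh, Real.norm_eq_abs, abs_of_nonneg (sub_nonneg.2 (Real.tanh_sq_lt_one x).le)]
      linarith [sq_nonneg (Real.tanh x)]) convex_univ trivial trivial
  simpa using this

theorem tanh_abs (x : ℝ) : Real.tanh |x| = |Real.tanh x| := by
  rcases le_total 0 x with h | h
  · rw [abs_of_nonneg h, abs_of_nonneg (tanh_nonneg h)]
  · rw [abs_of_nonpos h, Real.tanh_neg, abs_of_nonpos]
    have := tanh_nonneg (neg_nonneg.2 h)
    rw [Real.tanh_neg] at this
    linarith

theorem concaveOn_tanh : ConcaveOn ℝ (Set.Ici 0) Real.tanh := by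
  refine AntitoneOn.concaveOn_of_deriv (convex_Ici 0) continuous_tanh.continuousOn
    (fun x _ => (hasDerivAt_tanh x).differentiableAt.differentiableWithinAt) ?_
  rw [deriv_tanh, interior_Ici]
  intro x hx y hy hxy
  have h1 := tanh_nonneg (le_of_lt hx)
  have h2 := monotone_tanh hxy
  simp only
  nlinarith

theorem tanh_mPlus (β : ℝ) : Real.tanh (β * mPlus β) = mPlus β := (isGreatest_mPlus β).1.symm

theorem mPlus_lt_one (β : ℝ) : mPlus β < 1 := by
  rw [← tanh_mPlus]
  exact Real.tanh_lt_one _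

/-! ### The Curie–Weiss pressure and its maximizers -/

/-- Minus the second derivative of `pressure β` at `mPlus β`. -/
def curvature (β : ℝ) : ℝ := β * (1 - β * (1 - mPlus β ^ 2))

theorem curvature_pos {β : ℝ} (hβ : 1 < β) : 0 < curvature β := by
  have h := variance_pos hβ
  have hm := mPlus_pos hβ
  have hm1 := mPlus_lt_one β
  have hnum : 0 < 1 - mPlus β ^ 2 := by nlinarith
  exact mul_pos (by linarith) ((div_pos_iff_of_pos_left hnum).1 h)

/-- The auxiliary Hubbard–Stratonovich variable has limiting variance `1 / curvature β`, which is
the variance of the magnetization plus that of an independent Gaussian of variance `1 / β`. This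
identity identifies the difference. -/
theorem variance_eq {β : ℝ} (hβ : 1 < β) : variance β = 1 / curvature β - 1 / β := by
  have h := (curvature_pos hβ).ne'
  have hβ0 : β ≠ 0 := by positivity
  unfold curvature at *
  unfold variance
  have h' := right_ne_zero_of_mul h
  have e : 1 - mPlus β ^ 2 = (1 - (1 - β * (1 - mPlus β ^ 2))) / β := by
    field_simp
    ring
  generalize 1 - β * (1 - mPlus β ^ 2) = D at *
  rw [e]
  field_simp

/-- The exponential rate `log cosh (β x) - β x² / 2` of the Curie–Weiss model. -/
def pressure (β x : ℝ) : ℝ := Real.log (Real.cosh (β * x)) - β * x ^ 2 / 2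

theorem pressure_abs (β x : ℝ) : pressure β |x| = pressure β x := by
  rcases abs_choice x with h | h <;> simp [h, pressure]

theorem pressure_neg (β x : ℝ) : pressure β (-x) = pressure β x := by simp [pressure]

theorem pressure_zero (β : ℝ) : pressure β 0 = 0 := by simp [pressure]

theorem hasDerivAt_pressure (β x : ℝ) :
    HasDerivAt (pressure β) (β * (Real.tanh (β * x) - x)) x := by
  have h1 : HasDerivAt (fun z : ℝ => β * z) β x := by
    simpa using (hasDerivAt_id x).const_mul β
  have h2 := (h1.cosh.log (Real.cosh_pos _).ne').sub
    (((hasDerivAt_id x).pow 2).const_mul (β / 2))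
  refine (h2.congr_deriv ?_).congr_of_eventuallyEq (Eventually.of_forall fun z => ?_)
  · rw [Real.tanh_eq_sinh_div_cosh]
    simp
    ring
  · simp [pressure]
    ring

theorem continuous_pressure (β : ℝ) : Continuous (pressure β) :=
  continuous_iff_continuousAt.2 fun x => (hasDerivAt_pressure β x).continuousAt

/-- The function is the derivative of `pressure β`, so this is the second derivative at the
maximizer. -/
theorem hasDerivAt_mul_tanh_sub (β : ℝ) :
    HasDerivAt (fun x => β * (Real.tanh (β * x) - x)) (-curvature β) (mPlus β) := by
  have h1 : HasDerivAt (fun z : ℝ => β * z) β (mPlus β) := by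
    simpa using (hasDerivAt_id (mPlus β)).const_mul β
  have h2 := ((hasDerivAt_tanh (β * mPlus β)).comp (mPlus β) h1).sub (hasDerivAt_id (mPlus β))
  refine (h2.const_mul β).congr_deriv ?_
  rw [tanh_mPlus]
  unfold curvature
  ring

/-- The quotient `cosh (y + d) / cosh y` is the exponential moment at `d` of a `±1` variable with
mean `tanh y`; the bound is Jensen's inequality. -/
theorem exp_tanh_mul_le (y d : ℝ) :
    Real.exp (Real.tanh y * d) * Real.cosh y ≤ Real.cosh (y + d) := by
  have ht := abs_le.1 (Real.abs_tanh_lt_one y).le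
  have hC := Real.cosh_pos y
  have h := convexOn_exp.2 (Set.mem_univ d) (Set.mem_univ (-d))
    (show 0 ≤ (1 + Real.tanh y) / 2 by linarith) (show 0 ≤ (1 - Real.tanh y) / 2 by linarith)
    (by ring)
  simp only [smul_eq_mul] at h
  have e1 : (1 + Real.tanh y) / 2 * d + (1 - Real.tanh y) / 2 * -d = Real.tanh y * d := by ring
  rw [e1] at h
  have h2 := mul_le_mul_of_nonneg_right h hC.le
  refine h2.trans (le_of_eq ?_)
  have hs : Real.tanh y * Real.cosh y = Real.sinh y := by
    rw [Real.tanh_eq_sinh_div_cosh]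
    field_simp
  rw [Real.cosh_add, ← hs, Real.cosh_eq d, Real.sinh_eq d]
  ring

/-- Jensen's inequality at the fixed point `m = tanh (β m)` cancels the linear term. Its quadratic
coefficient is `β / 2`, so the resulting Gaussian integral has the same prefactor as the
Hubbard–Stratonovich transformation. -/
theorem pressure_ge (β x : ℝ) :
    pressure β (mPlus β) - β / 2 * (x - mPlus β) ^ 2 ≤ pressure β x := by
  have h := exp_tanh_mul_le (β * mPlus β) (β * (x - mPlus β))
  rw [tanh_mPlus] at h
  have h2 := Real.log_le_log (mul_pos (Real.exp_pos _) (Real.cosh_pos _)) h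
  rw [Real.log_mul (Real.exp_pos _).ne' (Real.cosh_pos _).ne', Real.log_exp] at h2
  have e : β * mPlus β + β * (x - mPlus β) = β * x := by ring
  rw [e] at h2
  unfold pressure
  nlinarith

/-- The graph of the concave function `tanh` lies above its chord from `0` to `β m`. -/
theorem le_tanh_of_le_mPlus {β : ℝ} (hβ : 1 < β) {y : ℝ} (hy : 0 < y) (hym : y ≤ mPlus β) :
    y ≤ Real.tanh (β * y) := by
  have hm := mPlus_pos hβ
  have h := concaveOn_tanh.2 (show (0 : ℝ) ∈ Set.Ici 0 by simp)
    (show β * mPlus β ∈ Set.Ici 0 by simp only [Set.mem_Ici]; positivity)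
    (sub_nonneg.2 ((div_le_one hm).2 hym)) (show 0 ≤ y / mPlus β by positivity) (by ring)
  rw [tanh_mPlus] at h
  simp only [smul_eq_mul, Real.tanh_zero, mul_zero, zero_add] at h
  rw [div_mul_cancel₀ _ hm.ne'] at h
  refine h.trans (le_of_eq ?_)
  congr 1
  field_simp

/-- The pressure starts at `0` and is monotone up to `m`. If it were not positive at `m`, it would
vanish identically on `[0, m]`, and its second derivative at `m` from the left would be `0` instead
of `-curvature β`. -/
theorem pressure_mPlus_pos {β : ℝ} (hβ : 1 < β) : 0 < pressure β (mPlus β) := by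
  have hm := mPlus_pos hβ
  by_contra! hle
  have hmono : MonotoneOn (pressure β) (Set.Icc 0 (mPlus β)) := by
    refine monotoneOn_of_deriv_nonneg (convex_Icc _ _) (continuous_pressure β).continuousOn
      (fun x _ => (hasDerivAt_pressure β x).differentiableAt.differentiableWithinAt) ?_
    intro x hx
    rw [interior_Icc] at hx
    rw [(hasDerivAt_pressure β x).deriv]
    exact mul_nonneg (by linarith) (sub_nonneg.2 (le_tanh_of_le_mPlus hβ hx.1 hx.2.le))
  have hz : ∀ x ∈ Set.Icc 0 (mPlus β), pressure β x = 0 := by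
    intro x hx
    have h1 := hmono (Set.left_mem_Icc.2 hm.le) hx hx.1
    have h2 := hmono hx (Set.right_mem_Icc.2 hm.le) hx.2
    rw [pressure_zero] at h1
    linarith
  have hm2 := hasDerivAt_mul_tanh_sub β
  have hm3 : HasDerivWithinAt (fun x => β * (Real.tanh (β * x) - x)) 0 (Set.Iio (mPlus β))
      (mPlus β) := by
    refine (hasDerivWithinAt_const _ _ (0 : ℝ)).congr_of_eventuallyEq ?_ ?_
    · filter_upwards [Ioo_mem_nhdsLT hm] with x hx
      have : HasDerivAt (pressure β) 0 x := by
        refine (hasDerivAt_const x (0 : ℝ)).congr_of_eventuallyEq ?_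
        filter_upwards [Ioo_mem_nhds hx.1 hx.2] with y hy
        exact hz y ⟨hy.1.le, hy.2.le⟩
      exact (hasDerivAt_pressure β x).unique this
    · rw [tanh_mPlus]; ring
  have := (uniqueDiffWithinAt_Iio (mPlus β)).eq_deriv _ hm2.hasDerivWithinAt hm3
  linarith [curvature_pos hβ]

/-- A global quadratic upper bound for the pressure around its maximizers `± mPlus β`. -/
theorem exists_pressure_le {β : ℝ} (hβ : 1 < β) : ∃ κ : ℝ, 0 < κ ∧
    ∀ x, pressure β x ≤ pressure β (mPlus β) - κ * (|x| - mPlus β) ^ 2 := by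
  set m := mPlus β with hm_def
  have hm : 0 < m := mPlus_pos hβ
  have hβ0 : 0 < β := by linarith
  have hcurv := curvature_pos hβ
  have hpp := pressure_mPlus_pos hβ
  -- The first entry makes the derivative of `F'` at `m` nonnegative, the second makes `F 0 ≥ 0`.
  -- Together with the convexity of `F'` on the half line these two conditions suffice.
  set κ := min (curvature β / 2) (pressure β m / m ^ 2) with hκ_def
  have hκ : 0 < κ := lt_min (by positivity) (div_pos hpp (by positivity))
  have hκ1 : 2 * κ ≤ curvature β := by
    have := min_le_left (curvature β / 2) (pressure β m / m ^ 2)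
    linarith
  have hκ2 : κ * m ^ 2 ≤ pressure β m := by
    have := min_le_right (curvature β / 2) (pressure β m / m ^ 2)
    rwa [← le_div_iff₀ (by positivity)]
  refine ⟨κ, hκ, fun x => ?_⟩
  rw [← pressure_abs β x]
  generalize hy : |x| = y
  have hy0 : 0 ≤ y := hy ▸ abs_nonneg x
  set F : ℝ → ℝ := fun x => pressure β m - pressure β x - κ * (x - m) ^ 2 with hF
  set F' : ℝ → ℝ := fun x => β * (x - Real.tanh (β * x)) - 2 * κ * (x - m) with hF'
  have hd : ∀ x, HasDerivAt F (F' x) x := by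
    intro x
    have h1 := (((hasDerivAt_pressure β x).const_sub (pressure β m)).sub
      ((((hasDerivAt_id x).sub_const m).pow 2).const_mul κ))
    refine h1.congr_deriv ?_
    simp [hF']
    ring
  have hF'm : F' m = 0 := by
    simp only [hF']
    rw [tanh_mPlus]
    ring
  have hF'd : HasDerivAt F' (curvature β - 2 * κ) m := by
    refine (((hasDerivAt_mul_tanh_sub β).neg).sub
      (((hasDerivAt_id m).sub_const m).const_mul (2 * κ))).congr_deriv ?_ |>.congr_of_eventuallyEq
      (Eventually.of_forall fun x => ?_)
    · ring
    · simp [hF']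
      ring
  have hconv : ConvexOn ℝ (Set.Ici 0) F' := by
    refine ⟨convex_Ici 0, fun a ha b hb s t hs ht hst => ?_⟩
    have h := concaveOn_tanh.2 (show β * a ∈ Set.Ici 0 from mul_nonneg hβ0.le ha)
      (show β * b ∈ Set.Ici 0 from mul_nonneg hβ0.le hb) hs ht hst
    simp only [smul_eq_mul, hF'] at h ⊢
    rw [show s * (β * a) + t * (β * b) = β * (s * a + t * b) by ring] at h
    have h' := mul_le_mul_of_nonneg_left h hβ0.le
    have e : 2 * κ * m = 2 * κ * m * (s + t) := by rw [hst, mul_one]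
    nlinarith
  have hFm : F m = 0 := by simp [hF]
  have hF0 : 0 ≤ F 0 := by
    simp only [hF, pressure_zero]
    linarith
  have hcont : Continuous F := continuous_iff_continuousAt.2 fun x => (hd x).continuousAt
  suffices h : 0 ≤ F y by simp only [hF] at h; linarith
  by_contra! hneg
  rcases lt_trichotomy y m with hlt | heq | hgt
  · have hypos : 0 < y := by
      rcases hy0.eq_or_lt with h | h
      · rw [← h] at hneg; linarith
      · exact h
    obtain ⟨z, hz, hzs⟩ := exists_hasDerivAt_eq_slope F F' hypos hcont.continuousOn
      (fun x _ => hd x)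
    -- `F` has dropped from `F 0 ≥ 0` to `F y < 0`, so `F'` is nonpositive somewhere before `y`. By
    -- convexity it stays so up to its zero `m`, and `F` cannot climb back to `F m = 0`.
    have hz' : F' z ≤ 0 := by
      rw [hzs]
      exact div_nonpos_of_nonpos_of_nonneg (by linarith) (by linarith)
    have hle : ∀ w ∈ Set.Icc z m, F' w ≤ 0 := by
      intro w hw
      have := hconv.le_on_segment (show z ∈ Set.Ici 0 from hz.1.le)
        (show m ∈ Set.Ici 0 from hm.le) (z := w)
        (by rw [segment_eq_Icc (hz.2.trans hlt).le]; exact hw)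
      rw [hF'm, max_eq_right hz'] at this
      exact this
    obtain ⟨w, hw, hws⟩ := exists_hasDerivAt_eq_slope F F' hlt hcont.continuousOn
      (fun x _ => hd x)
    have h1 := hle w ⟨(hz.2.trans hw.1).le, hw.2.le⟩
    rw [hws, hFm] at h1
    have : 0 < (0 - F y) / (m - y) := div_pos (by linarith) (by linarith)
    linarith
  · rw [heq, hFm] at hneg
    exact lt_irrefl _ hneg
  · obtain ⟨w, hw, hws⟩ := exists_hasDerivAt_eq_slope F F' hgt hcont.continuousOn
      (fun x _ => hd x)
    have h1 : F' w < 0 := by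
      rw [hws, hFm]
      exact div_neg_of_neg_of_pos (by linarith) (by linarith)
    -- To the right of `m` the convex function `F'` lies above its tangent at `m`, which has
    -- nonnegative slope by the choice of `κ`.
    have h2 := hconv.le_slope_of_hasDerivAt (show m ∈ Set.Ici 0 from hm.le)
      (show w ∈ Set.Ici 0 from hm.le.trans hw.1.le) hw.1 hF'd
    rw [slope_def_field, hF'm, sub_zero] at h2
    have : F' w / (w - m) < 0 := div_neg_of_neg_of_pos h1 (by linarith [hw.1])
    linarith

/-- A single application of l'Hôpital's rule suffices: the quotient of derivatives is a difference
quotient of the first derivative at `m`. -/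
theorem tendsto_pressure_sub_div_sq {β : ℝ} :
    Tendsto (fun x => (pressure β x - pressure β (mPlus β)) / (x - mPlus β) ^ 2)
      (𝓝[≠] (mPlus β)) (𝓝 (-(curvature β / 2))) := by
  set m := mPlus β with hm
  have hd2 := hasDerivAt_mul_tanh_sub β
  refine HasDerivAt.lhopital_zero_nhdsNE (f' := fun x => β * (Real.tanh (β * x) - x))
    (g' := fun x => 2 * (x - m)) ?_ ?_ ?_ ?_ ?_ ?_
  · exact Eventually.of_forall fun x => (hasDerivAt_pressure β x).sub_const _
  · refine Eventually.of_forall fun x => ?_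
    have := ((hasDerivAt_id x).sub_const m).pow 2
    refine this.congr_deriv ?_
    simp
  · filter_upwards [self_mem_nhdsWithin] with x hx
    exact mul_ne_zero two_ne_zero (sub_ne_zero.2 hx)
  · have : Continuous fun x => pressure β x - pressure β m :=
      (continuous_pressure β).sub continuous_const
    simpa using (this.tendsto m).mono_left nhdsWithin_le_nhds
  · have : Continuous fun x : ℝ => (x - m) ^ 2 := by fun_prop
    simpa using (this.tendsto m).mono_left nhdsWithin_le_nhds
  · have h := (hasDerivAt_iff_tendsto_slope.1 hd2).div_const 2
    rw [neg_div] at h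
    refine h.congr fun x => ?_
    rw [slope_def_field, tanh_mPlus, ← hm, sub_self, mul_zero, sub_zero, div_div, mul_comm (x - m)]

theorem tendsto_mul_pressure_sub {β : ℝ} (z : ℝ) :
    Tendsto (fun N : ℕ => (N : ℝ) * (pressure β (mPlus β + z / √(N : ℝ)) - pressure β (mPlus β)))
      atTop (𝓝 (-(curvature β / 2) * z ^ 2)) := by
  -- The preceding limit is along punctured neighbourhoods, which `m + z / √N` reaches only for `z ≠
  -- 0`.
  rcases eq_or_ne z 0 with rfl | hz
  · simp
  have h1 : Tendsto (fun N : ℕ => mPlus β + z / √(N : ℝ)) atTop (𝓝[≠] (mPlus β)) := by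
    refine tendsto_nhdsWithin_iff.2 ⟨?_, ?_⟩
    · simpa using (tendsto_const_nhds (x := mPlus β)).add (tendsto_const_nhds (x := z).div_atTop tendsto_sqrt_natCast)
    · filter_upwards [eventually_gt_atTop 0] with N hN
      have : √(N : ℝ) ≠ 0 := by positivity
      simp [hz, hN.ne']
  refine ((tendsto_pressure_sub_div_sq.comp h1).mul_const (z ^ 2)).congr' ?_
  filter_upwards [eventually_gt_atTop 0] with N hN
  have hN' : (0 : ℝ) < N := by exact_mod_cast hN
  simp only [Function.comp, add_sub_cancel_left, div_pow, Real.sq_sqrt hN'.le]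
  field_simp

/-! ### Curie–Weiss weights, overlaps and exponential moments of product weights -/

/-- The Gibbs weight `exp (β M² / (2 N))` of the Curie–Weiss model. -/
def curieWeissWeight (β : ℝ) {N : ℕ} (σ : Config N) : ℝ :=
  Real.exp (β * totalSpin σ ^ 2 / (2 * N))

theorem curieWeissWeight_pos (β : ℝ) {N : ℕ} (σ : Config N) : 0 < curieWeissWeight β σ :=
  Real.exp_pos _

theorem spin_eq_or {N : ℕ} (σ : Config N) (i : Fin N) : spin σ i = 1 ∨ spin σ i = -1 := by
  rcases Int.units_eq_one_or (σ i) with h | h <;> simp [spin, h]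

theorem abs_spin {N : ℕ} (σ : Config N) (i : Fin N) : |spin σ i| = 1 := by
  rcases spin_eq_or σ i with h | h <;> simp [h]

theorem spin_mul_self {N : ℕ} (σ : Config N) (i : Fin N) : spin σ i * spin σ i = 1 := by
  rcases spin_eq_or σ i with h | h <;> simp [h]

theorem abs_totalSpin_le {N : ℕ} (σ : Config N) : |totalSpin σ| ≤ N := by
  refine (Finset.abs_sum_le_sum_abs _ _).trans ?_
  simp [abs_spin]

/-- The overlap `∑ i, σ_i τ_i`. -/
def overlap {N : ℕ} (σ τ : Config N) : ℝ := ∑ i, spin σ i * spin τ i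

theorem abs_overlap_le {N : ℕ} (σ τ : Config N) : |overlap σ τ| ≤ N := by
  refine (Finset.abs_sum_le_sum_abs _ _).trans ?_
  simp [abs_mul, abs_spin]

/-- An exponential moment bound for sums of independent centred variables bounded by `2`, written
for an unnormalized product weight. -/
theorem sum_prod_mul_exp_abs_le {α : Type*} [Fintype α] (N : ℕ) (w : α → ℝ) (hw : ∀ a, 0 ≤ w a)
    (f : α → ℝ) (hf : ∀ a, |f a| ≤ 2) (hmean : ∑ a, w a * f a = 0)
    (θ : ℝ) (hθ0 : 0 ≤ θ) (hθ : 2 * θ ≤ 1) :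
    ∑ s : Fin N → α, (∏ i, w (s i)) * Real.exp (θ * |∑ i, f (s i)|) ≤
      2 * (∑ a, w a) ^ N * Real.exp (4 * N * θ ^ 2) := by
  have hW : 0 ≤ ∑ a, w a := Finset.sum_nonneg fun a _ => hw a
  have one : ∀ t : ℝ, |t| = θ →
      ∑ s : Fin N → α, (∏ i, w (s i)) * Real.exp (t * ∑ i, f (s i)) ≤
        (∑ a, w a) ^ N * Real.exp (4 * N * θ ^ 2) := by
    intro t ht
    have h1 : ∑ a, w a * Real.exp (t * f a) ≤ (∑ a, w a) * Real.exp (4 * θ ^ 2) := by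
      -- This is `exp y ≤ 1 + y + y²` for `|y| ≤ 1`, which uses `2 * θ ≤ 1`; the linear term
      -- disappears on summation by `hmean`.
      have h2 : ∀ a, w a * Real.exp (t * f a) ≤ w a * (1 + 4 * θ ^ 2) + t * (w a * f a) := by
        intro a
        have h3 : |t * f a| ≤ 2 * θ := by
          rw [abs_mul, ht, mul_comm]
          exact mul_le_mul_of_nonneg_right (hf a) hθ0
        have h4 := (abs_le.1 (Real.abs_exp_sub_one_sub_id_le (h3.trans hθ))).2
        have h5 : (t * f a) ^ 2 ≤ 4 * θ ^ 2 := by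
          rw [← sq_abs]
          nlinarith [abs_nonneg (t * f a)]
        nlinarith [hw a]
      refine (Finset.sum_le_sum fun a _ => h2 a).trans ?_
      rw [Finset.sum_add_distrib, ← Finset.sum_mul, ← Finset.mul_sum, hmean, mul_zero, add_zero]
      refine mul_le_mul_of_nonneg_left ?_ hW
      linarith [Real.add_one_le_exp (4 * θ ^ 2)]
    have h2 : ∑ s : Fin N → α, (∏ i, w (s i)) * Real.exp (t * ∑ i, f (s i)) =
        (∑ a, w a * Real.exp (t * f a)) ^ N := by
      rw [Fintype.sum_pow]
      refine Finset.sum_congr rfl fun s _ => ?_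
      rw [Finset.prod_mul_distrib, ← Real.exp_sum, Finset.mul_sum]
    rw [h2]
    refine (pow_le_pow_left₀ (Finset.sum_nonneg fun a _ => mul_nonneg (hw a) (Real.exp_pos _).le)
      h1 N).trans (le_of_eq ?_)
    rw [mul_pow, ← Real.exp_nat_mul]
    congr 2
    ring
  have h1 := one θ (abs_of_nonneg hθ0)
  have h2 := one (-θ) (by rw [abs_neg, abs_of_nonneg hθ0])
  calc _ ≤ ∑ s : Fin N → α, ((∏ i, w (s i)) * Real.exp (θ * ∑ i, f (s i)) +
        (∏ i, w (s i)) * Real.exp (-θ * ∑ i, f (s i))) := by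
        refine Finset.sum_le_sum fun s _ => ?_
        rw [← mul_add]
        refine mul_le_mul_of_nonneg_left ?_ (Finset.prod_nonneg fun i _ => hw _)
        rcases abs_choice (∑ i, f (s i)) with h | h <;> rw [h]
        · linarith [Real.exp_pos (-θ * ∑ i, f (s i))]
        · rw [mul_neg, ← neg_mul]
          linarith [Real.exp_pos (θ * ∑ i, f (s i))]
    _ ≤ _ := by rw [Finset.sum_add_distrib]; linarith

/-! ### Hubbard–Stratonovich transformation and bounds on the Laplace integral -/

/-- Completing the square: relative to its total mass, the weight in `x` is Gaussian with mean `M /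
N` and variance `1 / (N β)`, and the right side is its characteristic function. The case `t = 0` is
the Hubbard–Stratonovich identity. -/
theorem integral_cexp_mul_spin {β : ℝ} (hβ : 0 < β) {N : ℕ} (hN : 0 < N) (M t : ℝ) :
    ∫ x : ℝ, Complex.exp (-(N * β / 2) * x ^ 2 + (β * M + t * Complex.I) * x) =
      √(2 * Real.pi / (N * β)) * Real.exp (β * M ^ 2 / (2 * N)) *
        (Complex.exp (t * (M / N) * Complex.I) * Real.exp (-(t ^ 2 / (2 * (N * β))))) := by
  have hN' : (0 : ℝ) < N := by exact_mod_cast hN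
  have hNC : (N : ℂ) ≠ 0 := by exact_mod_cast hN.ne'
  have hβC : (β : ℂ) ≠ 0 := by exact_mod_cast hβ.ne'
  have h := integral_cexp_quadratic (b := -(N * β / 2)) (by
    have : (-(N * β / 2) : ℂ) = ((-(N * β / 2) : ℝ) : ℂ) := by push_cast; ring
    rw [this, Complex.ofReal_re]
    have : 0 < N * β := by positivity
    linarith) (β * M + t * Complex.I) 0
  simp only [add_zero] at h
  rw [h]
  have e1 : ((Real.pi : ℂ) / -(-(N * β / 2))) ^ (1 / 2 : ℂ) = (√(2 * Real.pi / (N * β)) : ℝ) := by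
    rw [Real.sqrt_eq_rpow, Complex.ofReal_cpow (by positivity)]
    congr 1
    · push_cast
      field_simp
    · push_cast
      ring
  rw [e1, mul_assoc]
  congr 1
  push_cast
  rw [← Complex.exp_add, ← Complex.exp_add]
  congr 1
  field_simp
  ring_nf
  simp only [Complex.I_sq]
  ring

theorem integral_exp_mul_spin {β : ℝ} (hβ : 0 < β) {N : ℕ} (hN : 0 < N) (M : ℝ) :
    ∫ x : ℝ, Real.exp (-(N * β / 2) * x ^ 2 + β * M * x) =
      √(2 * Real.pi / (N * β)) * Real.exp (β * M ^ 2 / (2 * N)) := by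
  have h := integral_cexp_mul_spin hβ hN M 0
  have e : ∀ x : ℝ, Complex.exp (-(N * β / 2) * x ^ 2 + (β * M + (0 : ℝ) * Complex.I) * x) =
      ((Real.exp (-(N * β / 2) * x ^ 2 + β * M * x) : ℝ) : ℂ) := by
    intro x
    push_cast
    congr 1
    ring
  simp_rw [e] at h
  rw [integral_complex_ofReal] at h
  have h' : ((√(2 * Real.pi / (N * β)) * Real.exp (β * M ^ 2 / (2 * N)) : ℝ) : ℂ) =
      √(2 * Real.pi / (N * β)) * Real.exp (β * M ^ 2 / (2 * N)) *
        (Complex.exp ((0 : ℝ) * (M / N) * Complex.I) *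
          Real.exp (-((0 : ℝ) ^ 2 / (2 * (N * β))))) := by
    simp
  rw [← h'] at h
  exact_mod_cast h

theorem integrable_exp_mul_spin {β : ℝ} (hβ : 0 < β) {N : ℕ} (hN : 0 < N) (M : ℝ) :
    Integrable fun x : ℝ => Real.exp (-(N * β / 2) * x ^ 2 + β * M * x) := by
  -- The integral of a non-integrable function is `0` by convention, so a nonzero value proves
  -- integrability.
  refine Integrable.of_integral_ne_zero ?_
  rw [integral_exp_mul_spin hβ hN]
  have : (0 : ℝ) < N := by exact_mod_cast hN
  have := Real.pi_pos
  positivity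

/-- The Hubbard–Stratonovich transformation. -/
theorem sqrt_mul_curieWeissWeight {β : ℝ} (hβ : 0 < β) {N : ℕ} (hN : 0 < N) (σ : Config N) :
    √(2 * Real.pi / (N * β)) * curieWeissWeight β σ =
      ∫ x : ℝ, Real.exp (-(N * β / 2) * x ^ 2 + β * totalSpin σ * x) :=
  (integral_exp_mul_spin hβ hN _).symm

theorem sum_units_exp (y : ℝ) : ∑ s : ℤˣ, Real.exp (y * ((s : ℤ) : ℝ)) = 2 * Real.cosh y := by
  rw [show (Finset.univ : Finset ℤˣ) = {1, -1} by decide, Finset.sum_pair (by decide), Real.cosh_eq]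
  simp
  ring

theorem exp_mul_totalSpin {N : ℕ} (y : ℝ) (σ : Config N) :
    Real.exp (y * totalSpin σ) = ∏ i, Real.exp (y * ((σ i : ℤ) : ℝ)) := by
  rw [← Real.exp_sum, ← Finset.mul_sum]
  rfl

theorem sum_exp_mul_totalSpin (N : ℕ) (y : ℝ) :
    ∑ σ : Config N, Real.exp (y * totalSpin σ) = (2 * Real.cosh y) ^ N := by
  simp_rw [exp_mul_totalSpin]
  rw [← sum_units_exp, Fintype.sum_pow]

theorem exp_mul_cosh_pow (β x : ℝ) (N : ℕ) :
    Real.exp (-(N * β / 2) * x ^ 2) * (2 * Real.cosh (β * x)) ^ N =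
      2 ^ N * Real.exp (N * pressure β x) := by
  have h : Real.cosh (β * x) ^ N = Real.exp (N * Real.log (Real.cosh (β * x))) := by
    rw [Real.exp_nat_mul, Real.exp_log (Real.cosh_pos _)]
  rw [mul_pow, h, mul_left_comm, ← Real.exp_add]
  congr 2
  unfold pressure
  ring

/-- For fixed `x` the spins decouple, and their sum is `(2 cosh (β x))^N`. -/
theorem sum_curieWeissWeight {β : ℝ} (hβ : 0 < β) {N : ℕ} (hN : 0 < N) :
    √(2 * Real.pi / (N * β)) * ∑ σ : Config N, curieWeissWeight β σ =
      2 ^ N * ∫ x : ℝ, Real.exp (N * pressure β x) := by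
  rw [Finset.mul_sum]
  simp_rw [sqrt_mul_curieWeissWeight hβ hN]
  rw [← integral_finsetSum _ fun σ _ => integrable_exp_mul_spin hβ hN _, ← integral_const_mul]
  congr 1
  ext x
  rw [← exp_mul_cosh_pow, ← sum_exp_mul_totalSpin, Finset.mul_sum]
  refine Finset.sum_congr rfl fun σ _ => ?_
  rw [← Real.exp_add]
  congr 1
  ring

theorem sum_curieWeissWeight_pos (β : ℝ) (N : ℕ) : 0 < ∑ σ : Config N, curieWeissWeight β σ :=
  Finset.sum_pos (fun σ _ => curieWeissWeight_pos β σ) Finset.univ_nonempty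

theorem exp_neg_abs_sub_sq_le (q m x : ℝ) :
    Real.exp (-q * (|x| - m) ^ 2) ≤ Real.exp (-q * (x - m) ^ 2) + Real.exp (-q * (x + m) ^ 2) := by
  rcases abs_choice x with h | h <;> rw [h]
  · linarith [Real.exp_pos (-q * (x + m) ^ 2)]
  · rw [show (-x - m) ^ 2 = (x + m) ^ 2 by ring]
    linarith [Real.exp_pos (-q * (x - m) ^ 2)]

theorem integral_exp_pressure_ge {β : ℝ} (hβ : 0 < β) {N : ℕ} (hN : 0 < N)
    (hi : Integrable fun x => Real.exp (N * pressure β x)) :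
    Real.exp (N * pressure β (mPlus β)) * √(2 * Real.pi / (N * β)) ≤
      ∫ x, Real.exp (N * pressure β x) := by
  have hN' : (0 : ℝ) < N := by exact_mod_cast hN
  have hq : 0 < N * β / 2 := by positivity
  have e : 2 * Real.pi / (N * β) = Real.pi / (N * β / 2) := by field_simp
  rw [e, ← integral_gaussian, ← integral_sub_right_eq_self (fun x => Real.exp (-_ * x ^ 2))
    (mPlus β), ← integral_const_mul]
  refine integral_mono (((integrable_exp_neg_mul_sq hq).comp_sub_right _).const_mul _) hi ?_
  intro x
  simp only
  rw [← Real.exp_add]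
  refine Real.exp_le_exp.2 ?_
  have := mul_le_mul_of_nonneg_left (pressure_ge β x) hN'.le
  nlinarith

/-- Young's inequality absorbs the tilt into half of the quadratic decay `N κ (|x| - m)²`, at the
price `exp (b² / (2 κ))`. The two wells `± m` give the factor `2`, and `√(β / κ)` compares the
remaining Gaussian with the lower bound `integral_exp_pressure_ge`. -/
theorem exists_integral_exp_pressure_le {β : ℝ} (hβ : 1 < β) (b : ℝ) : ∃ C : ℝ, 0 < C ∧
    ∀ N : ℕ, 0 < N →
      Integrable (fun x => Real.exp (N * pressure β x + b * √(N : ℝ) * |(|x| - mPlus β)|)) ∧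
      ∫ x, Real.exp (N * pressure β x + b * √(N : ℝ) * |(|x| - mPlus β)|) ≤
        C * ∫ x, Real.exp (N * pressure β x) := by
  obtain ⟨κ, hκ, hle⟩ := exists_pressure_le hβ
  have hβ0 : 0 < β := by linarith
  set m := mPlus β
  refine ⟨Real.exp (b ^ 2 / (2 * κ)) * (2 * √(β / κ)), by positivity, fun N hN => ?_⟩
  have hN' : (0 : ℝ) < N := by exact_mod_cast hN
  set q := N * κ / 2 with hq_def
  have hq : 0 < q := by positivity
  have hbound : ∀ c x : ℝ, N * pressure β x + c * √(N : ℝ) * |(|x| - m)| ≤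
      (N * pressure β m + c ^ 2 / (2 * κ)) + -q * (|x| - m) ^ 2 := by
    intro c x
    have h1 := mul_le_mul_of_nonneg_left (hle x) hN'.le
    have h2 : c * √(N : ℝ) * |(|x| - m)| ≤ c ^ 2 / (2 * κ) + q * (|x| - m) ^ 2 := by
      have h3 : 0 ≤ (√(N : ℝ) * |(|x| - m)| * κ - c) ^ 2 / (2 * κ) := by positivity
      have h4 : (√(N : ℝ) * |(|x| - m)| * κ - c) ^ 2 / (2 * κ) =
          c ^ 2 / (2 * κ) + √(N : ℝ) ^ 2 * κ / 2 * |(|x| - m)| ^ 2 - c * √(N : ℝ) * |(|x| - m)| := by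
        field_simp
        ring
      rw [Real.sq_sqrt hN'.le, sq_abs, ← hq_def] at h4
      linarith
    nlinarith
  have hdom : ∀ c x : ℝ, Real.exp (N * pressure β x + c * √(N : ℝ) * |(|x| - m)|) ≤
      Real.exp (N * pressure β m + c ^ 2 / (2 * κ)) *
        (Real.exp (-q * (x - m) ^ 2) + Real.exp (-q * (x + m) ^ 2)) := by
    intro c x
    refine (Real.exp_le_exp.2 (hbound c x)).trans ?_
    rw [Real.exp_add]
    exact mul_le_mul_of_nonneg_left (exp_neg_abs_sub_sq_le q m x) (Real.exp_pos _).le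
  have hi1 : Integrable fun x : ℝ => Real.exp (-q * (x - m) ^ 2) :=
    (integrable_exp_neg_mul_sq hq).comp_sub_right m
  have hi2 : Integrable fun x : ℝ => Real.exp (-q * (x + m) ^ 2) :=
    (integrable_exp_neg_mul_sq hq).comp_add_right m
  have hmeas : ∀ c : ℝ, Continuous fun x =>
      Real.exp (N * pressure β x + c * √(N : ℝ) * |(|x| - m)|) := by
    intro c
    have := continuous_pressure β
    fun_prop
  have hint : ∀ c : ℝ, Integrable fun x =>
      Real.exp (N * pressure β x + c * √(N : ℝ) * |(|x| - m)|) := fun c =>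
    ((hi1.add hi2).const_mul _).mono' (hmeas c).aestronglyMeasurable
      (ae_of_all _ fun x => by
        rw [Real.norm_eq_abs, abs_of_pos (Real.exp_pos _)]
        exact hdom c x)
  refine ⟨hint b, ?_⟩
  have hup := integral_mono (hint b) ((hi1.add hi2).const_mul _) (hdom b)
  have hval : ∫ x : ℝ, (Real.exp (-q * (x - m) ^ 2) + Real.exp (-q * (x + m) ^ 2)) =
      2 * √(Real.pi / q) := by
    rw [integral_add hi1 hi2, integral_sub_right_eq_self (fun x => Real.exp (-q * x ^ 2)),
      integral_add_right_eq_self (fun x => Real.exp (-q * x ^ 2)), integral_gaussian]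
    ring
  have hup' : ∫ x, Real.exp (N * pressure β x + b * √(N : ℝ) * |(|x| - m)|) ≤
      Real.exp (N * pressure β m + b ^ 2 / (2 * κ)) * (2 * √(Real.pi / q)) := by
    rw [← hval, ← integral_const_mul]
    exact hup
  have hlow := integral_exp_pressure_ge hβ0 hN (by simpa using hint 0)
  refine hup'.trans ?_
  have h3 : √(Real.pi / q) = √(β / κ) * √(2 * Real.pi / (N * β)) := by
    rw [← Real.sqrt_mul (by positivity)]
    congr 1
    rw [hq_def]
    field_simp
  rw [h3, Real.exp_add]
  have h4 := mul_le_mul_of_nonneg_left hlow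
    (show 0 ≤ Real.exp (b ^ 2 / (2 * κ)) * (2 * √(β / κ)) by positivity)
  refine le_trans (le_of_eq ?_) h4
  ring

/-! ### Exponential moments of the magnetization and the overlap -/

/-- Given the auxiliary variable `x`, the spins have mean `tanh (β x)`. Since `tanh` is 1-Lipschitz
and `m = tanh (β m)`, this mean is as close to `± m` as `x` is, up to the factor `β`. -/
theorem abs_abs_tanh_sub_le {β : ℝ} (hβ : 0 < β) (x : ℝ) :
    |(|Real.tanh (β * x)| - mPlus β)| ≤ β * |(|x| - mPlus β)| := by
  rw [← tanh_abs, abs_mul, abs_of_pos hβ]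
  conv_lhs => rw [← tanh_mPlus β]
  refine (abs_tanh_sub_le _ _).trans (le_of_eq ?_)
  rw [← mul_sub, abs_mul, abs_of_pos hβ]

/-- The deviation of `|M|` from `N m⁺(β)` on the scale `√N`. -/
def spinDeviation (β : ℝ) {N : ℕ} (σ : Config N) : ℝ :=
  |(|totalSpin σ| - N * mPlus β)| / √(N : ℝ)

/-- The deviation of the modulus of the overlap from `N m⁺(β)²` on the scale `√N`. -/
def overlapDeviation (β : ℝ) {N : ℕ} (σ τ : Config N) : ℝ :=
  |(|overlap σ τ| - N * mPlus β ^ 2)| / √(N : ℝ)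

theorem sum_units_exp_mul (y : ℝ) :
    ∑ s : ℤˣ, Real.exp (y * ((s : ℤ) : ℝ)) * (((s : ℤ) : ℝ) - Real.tanh y) = 0 := by
  rw [show (Finset.univ : Finset ℤˣ) = {1, -1} by decide, Finset.sum_pair (by decide),
    Real.tanh_eq]
  have : Real.exp y + Real.exp (-y) ≠ 0 := by positivity
  simp
  field_simp
  ring

theorem abs_units_sub_le (s : ℤˣ) {t : ℝ} (ht : |t| ≤ 1) : |((s : ℤ) : ℝ) - t| ≤ 2 := by
  refine (abs_sub _ _).trans ?_
  rcases Int.units_eq_one_or s with rfl | rfl <;> simp <;> linarith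

theorem sum_sub_const {N : ℕ} (f : Fin N → ℝ) (c : ℝ) : ∑ i, (f i - c) = ∑ i, f i - N * c := by
  simp

theorem abs_abs_sub_le_of_le {x y m N d : ℝ} (hN : 0 ≤ N) (h : |(|y| - m)| ≤ d) :
    |(|x| - N * m)| ≤ |x - N * y| + N * d := by
  have h1 : |(|x| - |N * y|)| ≤ |x - N * y| := abs_abs_sub_abs_le_abs_sub _ _
  have h2 : |(|N * y| - N * m)| = N * |(|y| - m)| := by
    rw [abs_mul, abs_of_nonneg hN, ← mul_sub, abs_mul, abs_of_nonneg hN]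
  have h3 := abs_sub_le |x| |N * y| (N * m)
  have h4 := mul_le_mul_of_nonneg_left h hN
  linarith

/-- For fixed `x` the deviation is split into fluctuations of independent spins about their mean
`tanh (β x)`, bounded by `sum_prod_mul_exp_abs_le` with `θ = a / √N`, and the deviation of that
mean, which tilts the Laplace integral. -/
theorem sum_exp_mul_spinDeviation_le {β : ℝ} (hβ : 0 < β) {a : ℝ} (ha : 0 ≤ a) {N : ℕ}
    (hN : 0 < N) (haN : 2 * (a / √(N : ℝ)) ≤ 1) (x : ℝ) :
    ∑ σ : Config N, Real.exp (-(N * β / 2) * x ^ 2 + β * totalSpin σ * x) *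
        Real.exp (a * spinDeviation β σ) ≤
      2 * Real.exp (4 * a ^ 2) * 2 ^ N *
        Real.exp (N * pressure β x + a * β * √(N : ℝ) * |(|x| - mPlus β)|) := by
  have hN' : (0 : ℝ) < N := by exact_mod_cast hN
  have hs : 0 < √(N : ℝ) := Real.sqrt_pos.2 hN'
  have hss : √(N : ℝ) * √(N : ℝ) = N := Real.mul_self_sqrt hN'.le
  set T := Real.tanh (β * x)
  have hT : |T| ≤ 1 := (Real.abs_tanh_lt_one _).le
  have key := sum_prod_mul_exp_abs_le N (fun s : ℤˣ => Real.exp (β * x * ((s : ℤ) : ℝ)))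
    (fun s => (Real.exp_pos _).le) (fun s => ((s : ℤ) : ℝ) - T)
    (fun s => abs_units_sub_le s hT) (sum_units_exp_mul _) (a / √(N : ℝ)) (by positivity) haN
  rw [sum_units_exp] at key
  have e4 : 4 * (N : ℝ) * (a / √(N : ℝ)) ^ 2 = 4 * a ^ 2 := by
    rw [div_pow, Real.sq_sqrt hN'.le]
    field_simp
  rw [e4] at key
  have hpt : ∀ σ : Config N, Real.exp (-(N * β / 2) * x ^ 2 + β * totalSpin σ * x) *
        Real.exp (a * spinDeviation β σ) ≤
      Real.exp (-(N * β / 2) * x ^ 2) * Real.exp (a * β * √(N : ℝ) * |(|x| - mPlus β)|) *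
        ((∏ i, Real.exp (β * x * ((σ i : ℤ) : ℝ))) *
          Real.exp (a / √(N : ℝ) * |∑ i, (((σ i : ℤ) : ℝ) - T)|)) := by
    intro σ
    rw [← exp_mul_totalSpin, ← Real.exp_add, ← Real.exp_add, ← Real.exp_add, ← Real.exp_add]
    refine Real.exp_le_exp.2 ?_
    have h1 := abs_abs_sub_le_of_le (x := totalSpin σ) (y := T) (m := mPlus β) hN'.le
      (abs_abs_tanh_sub_le hβ x)
    have h2 : ∑ i, (((σ i : ℤ) : ℝ) - T) = totalSpin σ - N * T := sum_sub_const _ _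
    rw [h2]
    have h3 := mul_le_mul_of_nonneg_left h1 (show 0 ≤ a / √(N : ℝ) by positivity)
    have h4 : a * spinDeviation β σ = a / √(N : ℝ) * |(|totalSpin σ| - N * mPlus β)| := by
      unfold spinDeviation
      ring
    have h5 : a / √(N : ℝ) * (N * (β * |(|x| - mPlus β)|)) =
        a * β * √(N : ℝ) * |(|x| - mPlus β)| := by
      rw [div_mul_eq_mul_div, div_eq_iff hs.ne']
      nth_rewrite 1 [← hss]
      ring
    rw [mul_add, h5] at h3
    rw [h4]
    linarith
  refine (Finset.sum_le_sum fun σ _ => hpt σ).trans ?_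
  rw [← Finset.mul_sum]
  refine (mul_le_mul_of_nonneg_left key (by positivity)).trans (le_of_eq ?_)
  have h6 := exp_mul_cosh_pow β x N
  rw [Real.exp_add]
  linear_combination (2 * Real.exp (4 * a ^ 2) *
    Real.exp (a * β * √(N : ℝ) * |(|x| - mPlus β)|)) * h6

theorem eventually_two_mul_div_sqrt_le (a : ℝ) : ∀ᶠ N : ℕ in atTop, 2 * (a / √(N : ℝ)) ≤ 1 := by
  have := ((tendsto_const_nhds (x := a)).div_atTop tendsto_sqrt_natCast).const_mul 2
  rw [mul_zero] at this
  exact this.eventually (eventually_le_nhds one_pos)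

/-- Exponential moments of the magnetization in the Curie–Weiss model. -/
theorem exists_sum_curieWeissWeight_mul_exp_le {β : ℝ} (hβ : 1 < β) {a : ℝ} (ha : 0 ≤ a) :
    ∃ C : ℝ, 0 < C ∧ ∀ᶠ N : ℕ in atTop,
      ∑ σ : Config N, curieWeissWeight β σ * Real.exp (a * spinDeviation β σ) ≤
        C * ∑ σ : Config N, curieWeissWeight β σ := by
  have hβ0 : 0 < β := by linarith
  obtain ⟨C, hC, hle⟩ := exists_integral_exp_pressure_le hβ (a * β)
  refine ⟨2 * Real.exp (4 * a ^ 2) * C, by positivity, ?_⟩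
  filter_upwards [eventually_gt_atTop 0, eventually_two_mul_div_sqrt_le a] with N hN haN
  obtain ⟨hi, hint⟩ := hle N hN
  have hN' : (0 : ℝ) < N := by exact_mod_cast hN
  have hK : 0 < √(2 * Real.pi / (N * β)) := by
    have := Real.pi_pos
    positivity
  refine le_of_mul_le_mul_left ?_ hK
  have h1 := sum_curieWeissWeight hβ0 hN
  rw [mul_left_comm, h1, Finset.mul_sum]
  simp_rw [← mul_assoc (√(2 * Real.pi / (N * β))), sqrt_mul_curieWeissWeight hβ0 hN,
    ← integral_mul_const]
  rw [← integral_finsetSum _ fun σ _ => (integrable_exp_mul_spin hβ0 hN _).mul_const _]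
  refine (integral_mono_of_nonneg (ae_of_all _ fun x => Finset.sum_nonneg fun σ _ => by positivity)
    (hi.const_mul (2 * Real.exp (4 * a ^ 2) * 2 ^ N))
    (ae_of_all _ fun x => sum_exp_mul_spinDeviation_le hβ0 ha hN haN x)).trans ?_
  rw [integral_const_mul]
  have := mul_le_mul_of_nonneg_left hint (show 0 ≤ 2 * Real.exp (4 * a ^ 2) * 2 ^ N by positivity)
  linarith

theorem abs_mul_sub_sq_le {A B m d e : ℝ} (hA : |A| ≤ 1) (hm0 : 0 ≤ m) (hm : m ≤ 1)
    (hd : |(|A| - m)| ≤ d) (he : |(|B| - m)| ≤ e) : |(|A * B| - m ^ 2)| ≤ d + e := by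
  have h : |A * B| - m ^ 2 = |A| * (|B| - m) + m * (|A| - m) := by rw [abs_mul]; ring
  rw [h]
  refine (abs_add_le _ _).trans ?_
  rw [abs_mul, abs_mul, abs_abs, abs_of_nonneg hm0]
  have h1 : |A| * |(|B| - m)| ≤ 1 * e := mul_le_mul hA he (abs_nonneg _) zero_le_one
  have h2 : m * |(|A| - m)| ≤ 1 * d := mul_le_mul hm hd (abs_nonneg _) zero_le_one
  linarith

/-- For fixed `x` and `y` the products `σ_i τ_i` are independent with mean `tanh (β x) * tanh (β
y)`, so the one-replica argument applies with pairs of spins as letters. -/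
theorem sum_exp_mul_overlapDeviation_le {β : ℝ} (hβ : 1 < β) {a : ℝ} (ha : 0 ≤ a) {N : ℕ}
    (hN : 0 < N) (haN : 2 * (a / √(N : ℝ)) ≤ 1) (x y : ℝ) :
    ∑ σ : Config N, ∑ τ : Config N, Real.exp (-(N * β / 2) * x ^ 2 + β * totalSpin σ * x) *
        Real.exp (-(N * β / 2) * y ^ 2 + β * totalSpin τ * y) *
        Real.exp (a * overlapDeviation β σ τ) ≤
      2 * Real.exp (4 * a ^ 2) *
        (2 ^ N * Real.exp (N * pressure β x + a * β * √(N : ℝ) * |(|x| - mPlus β)|)) *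
        (2 ^ N * Real.exp (N * pressure β y + a * β * √(N : ℝ) * |(|y| - mPlus β)|)) := by
  have hβ0 : 0 < β := by linarith
  have hN' : (0 : ℝ) < N := by exact_mod_cast hN
  have hs : 0 < √(N : ℝ) := Real.sqrt_pos.2 hN'
  have hss : √(N : ℝ) * √(N : ℝ) = N := Real.mul_self_sqrt hN'.le
  set A := Real.tanh (β * x) with hA_def
  set B := Real.tanh (β * y) with hB_def
  have hA : |A| ≤ 1 := (Real.abs_tanh_lt_one _).le
  have hB : |B| ≤ 1 := (Real.abs_tanh_lt_one _).le
  have hAB : |A * B| ≤ 1 := by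
    rw [abs_mul]
    exact mul_le_one₀ hA (abs_nonneg _) hB
  let v : ℤˣ → ℝ := fun s => ((s : ℤ) : ℝ)
  have key := sum_prod_mul_exp_abs_le N
    (fun s : ℤˣ × ℤˣ => Real.exp (β * x * v s.1) * Real.exp (β * y * v s.2))
    (fun s => by positivity) (fun s => v s.1 * v s.2 - A * B)
    (fun s => by
      have := abs_units_sub_le (s.1 * s.2) hAB
      simpa [v] using this)
    (by
      rw [Fintype.sum_prod_type]
      have hx := sum_units_exp_mul (β * x)
      have hy := sum_units_exp_mul (β * y)
      -- The splitting `s t - A B = s (t - B) + (s - A) B` leaves in each term a factor that sums to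
      -- zero over one of the two spins.
      have e : ∀ s t : ℤˣ, Real.exp (β * x * v s) * Real.exp (β * y * v t) * (v s * v t - A * B) =
          (Real.exp (β * x * v s) * v s) * (Real.exp (β * y * v t) * (v t - B)) +
          (Real.exp (β * x * v s) * (v s - A)) * (Real.exp (β * y * v t) * B) := by
        intro s t; ring
      simp only [e, Finset.sum_add_distrib, ← Finset.mul_sum, ← Finset.sum_mul]
      simp only [v, hA_def, hB_def, hx, hy]
      simp)
    (a / √(N : ℝ)) (by positivity) haN
  have hZ : ∑ s : ℤˣ × ℤˣ, Real.exp (β * x * v s.1) * Real.exp (β * y * v s.2) =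
      (2 * Real.cosh (β * x)) * (2 * Real.cosh (β * y)) := by
    rw [Fintype.sum_prod_type, ← sum_units_exp, ← sum_units_exp, Finset.sum_mul_sum]
  have e4 : 4 * (N : ℝ) * (a / √(N : ℝ)) ^ 2 = 4 * a ^ 2 := by
    rw [div_pow, Real.sq_sqrt hN'.le]
    field_simp
  rw [hZ, e4, ← (Equiv.arrowProdEquivProdArrow (Fin N) (fun _ => ℤˣ) (fun _ => ℤˣ)).symm.sum_comp,
    Fintype.sum_prod_type] at key
  simp only [Equiv.arrowProdEquivProdArrow, Equiv.coe_fn_symm_mk] at key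
  set D := Real.exp (-(N * β / 2) * x ^ 2) * Real.exp (-(N * β / 2) * y ^ 2) *
    (Real.exp (a * β * √(N : ℝ) * |(|x| - mPlus β)|) *
      Real.exp (a * β * √(N : ℝ) * |(|y| - mPlus β)|)) with hD
  have hpt : ∀ σ τ : Config N, Real.exp (-(N * β / 2) * x ^ 2 + β * totalSpin σ * x) *
        Real.exp (-(N * β / 2) * y ^ 2 + β * totalSpin τ * y) *
        Real.exp (a * overlapDeviation β σ τ) ≤
      D * ((∏ i, Real.exp (β * x * v (σ i)) * Real.exp (β * y * v (τ i))) *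
          Real.exp (a / √(N : ℝ) * |∑ i, (v (σ i) * v (τ i) - A * B)|)) := by
    intro σ τ
    rw [Finset.prod_mul_distrib, ← exp_mul_totalSpin, ← exp_mul_totalSpin, hD]
    simp only [← Real.exp_add]
    refine Real.exp_le_exp.2 ?_
    have h1 := abs_abs_sub_le_of_le (x := overlap σ τ) (y := A * B) (m := mPlus β ^ 2) hN'.le
      (abs_mul_sub_sq_le hA (mPlus_pos hβ).le (mPlus_lt_one β).le
        (abs_abs_tanh_sub_le hβ0 x) (abs_abs_tanh_sub_le hβ0 y))
    have h2 : ∑ i, (v (σ i) * v (τ i) - A * B) = overlap σ τ - N * (A * B) := sum_sub_const _ _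
    rw [h2]
    have h3 := mul_le_mul_of_nonneg_left h1 (show 0 ≤ a / √(N : ℝ) by positivity)
    have h4 : a * overlapDeviation β σ τ =
        a / √(N : ℝ) * |(|overlap σ τ| - N * mPlus β ^ 2)| := by
      unfold overlapDeviation
      ring
    have h5 : a / √(N : ℝ) * (N * (β * |(|x| - mPlus β)| + β * |(|y| - mPlus β)|)) =
        a * β * √(N : ℝ) * |(|x| - mPlus β)| + a * β * √(N : ℝ) * |(|y| - mPlus β)| := by
      rw [div_mul_eq_mul_div, div_eq_iff hs.ne']
      nth_rewrite 1 [← hss]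
      ring
    rw [mul_add, h5] at h3
    rw [h4]
    linarith
  refine (Finset.sum_le_sum fun σ _ => Finset.sum_le_sum fun τ _ => hpt σ τ).trans ?_
  simp only [← Finset.mul_sum]
  refine (mul_le_mul_of_nonneg_left key (by positivity)).trans (le_of_eq ?_)
  have h6 := exp_mul_cosh_pow β x N
  have h7 := exp_mul_cosh_pow β y N
  have e6 := congrArg₂ (· * ·) h6 h7
  rw [Real.exp_add, Real.exp_add, mul_pow (2 * Real.cosh (β * x)), hD]
  linear_combination (2 * Real.exp (4 * a ^ 2) *
    Real.exp (a * β * √(N : ℝ) * |(|x| - mPlus β)|) *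
    Real.exp (a * β * √(N : ℝ) * |(|y| - mPlus β)|)) * e6

/-- Exponential moments of the overlap of two replicas in the Curie–Weiss model. -/
theorem exists_sum_curieWeissWeight_mul_exp_overlap_le {β : ℝ} (hβ : 1 < β) {a : ℝ}
    (ha : 0 ≤ a) : ∃ C : ℝ, 0 < C ∧ ∀ᶠ N : ℕ in atTop,
      ∑ σ : Config N, ∑ τ : Config N, curieWeissWeight β σ * curieWeissWeight β τ *
        Real.exp (a * overlapDeviation β σ τ) ≤
        C * (∑ σ : Config N, curieWeissWeight β σ) ^ 2 := by
  have hβ0 : 0 < β := by linarith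
  obtain ⟨C, hC, hle⟩ := exists_integral_exp_pressure_le hβ (a * β)
  refine ⟨2 * Real.exp (4 * a ^ 2) * C ^ 2, by positivity, ?_⟩
  filter_upwards [eventually_gt_atTop 0, eventually_two_mul_div_sqrt_le a] with N hN haN
  obtain ⟨hi, hint⟩ := hle N hN
  have hN' : (0 : ℝ) < N := by exact_mod_cast hN
  have hK : 0 < √(2 * Real.pi / (N * β)) := by
    have := Real.pi_pos
    positivity
  set K := √(2 * Real.pi / (N * β)) with hK_def
  refine le_of_mul_le_mul_left ?_ (pow_pos hK 2)
  have h1 := sum_curieWeissWeight hβ0 hN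
  rw [mul_left_comm, ← mul_pow, h1, Finset.mul_sum]
  have e : ∀ σ τ : Config N, K ^ 2 * (curieWeissWeight β σ * curieWeissWeight β τ *
        Real.exp (a * overlapDeviation β σ τ)) =
      ∫ z : ℝ × ℝ, Real.exp (-(N * β / 2) * z.1 ^ 2 + β * totalSpin σ * z.1) *
        Real.exp (-(N * β / 2) * z.2 ^ 2 + β * totalSpin τ * z.2) *
        Real.exp (a * overlapDeviation β σ τ) ∂((volume : Measure ℝ).prod volume) := by
    intro σ τ
    rw [integral_mul_const, integral_prod_mul
      (fun x => Real.exp (-(N * β / 2) * x ^ 2 + β * totalSpin σ * x))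
      (fun y => Real.exp (-(N * β / 2) * y ^ 2 + β * totalSpin τ * y)),
      ← sqrt_mul_curieWeissWeight hβ0 hN, ← sqrt_mul_curieWeissWeight hβ0 hN, ← hK_def]
    ring
  have hi2 : ∀ σ τ : Config N, Integrable (fun z : ℝ × ℝ =>
      Real.exp (-(N * β / 2) * z.1 ^ 2 + β * totalSpin σ * z.1) *
        Real.exp (-(N * β / 2) * z.2 ^ 2 + β * totalSpin τ * z.2) *
        Real.exp (a * overlapDeviation β σ τ)) ((volume : Measure ℝ).prod volume) := fun σ τ =>
    ((integrable_exp_mul_spin hβ0 hN _).mul_prod (integrable_exp_mul_spin hβ0 hN _)).mul_const _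
  simp_rw [Finset.mul_sum, e]
  simp_rw [← integral_finsetSum _ fun τ _ => hi2 _ τ]
  rw [← integral_finsetSum _ fun σ _ => integrable_finsetSum _ fun τ _ => hi2 σ τ]
  set H : ℝ → ℝ := fun x =>
    2 ^ N * Real.exp (N * pressure β x + a * β * √(N : ℝ) * |(|x| - mPlus β)|)
  have hH : Integrable H := hi.const_mul _
  refine (integral_mono_of_nonneg (g := fun z : ℝ × ℝ => 2 * Real.exp (4 * a ^ 2) * (H z.1 * H z.2))
    (ae_of_all _ fun x => Finset.sum_nonneg fun σ _ => Finset.sum_nonneg fun τ _ => by positivity)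
    ((hH.mul_prod hH).const_mul _)
    (ae_of_all _ fun z => ?_)).trans ?_
  · refine (sum_exp_mul_overlapDeviation_le hβ ha hN haN z.1 z.2).trans (le_of_eq ?_)
    simp only [H]
    ring
  rw [integral_const_mul, integral_prod_mul, mul_assoc _ (C ^ 2), ← mul_pow, ← sq]
  refine mul_le_mul_of_nonneg_left ?_ (by positivity)
  refine pow_le_pow_left₀ (integral_nonneg fun x => by positivity) ?_ 2
  rw [integral_const_mul]
  have := mul_le_mul_of_nonneg_left hint (show (0 : ℝ) ≤ 2 ^ N by positivity)
  linarith

/-! ### Exponential moments of the edge indicators -/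

/-- Cumulant expansion of a Bernoulli variable with mean `q` and variance `q (1 - q)`. The factor
`q` in the remainder is essential: `N²` edges with `x` of order `1 / (N q)` then give a total error
`1 / (N q²)`. The constant is `16` from the logarithm plus `2` from the remaining terms. -/
theorem abs_log_one_add_mul_exp_sub_one_le {q x : ℝ} (hq0 : 0 ≤ q) (hq1 : q ≤ 1)
    (hx : |x| ≤ 1 / 4) :
    |Real.log (1 + q * (Real.exp x - 1)) - (q * x + q * (1 - q) / 2 * x ^ 2)| ≤
      18 * q * |x| ^ 3 := by
  have hx0 := abs_nonneg x
  have hr := Real.exp_bound (x := x) (by linarith) (n := 3) (by norm_num)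
  simp only [Finset.sum_range_succ, Finset.sum_range_zero, Nat.factorial] at hr
  set r := Real.exp x - 1 - x - x ^ 2 / 2 with hr_def
  have hr' : |r| ≤ 2 / 9 * |x| ^ 3 := by
    have e : r = Real.exp x - (0 + x ^ 0 / ((1 : ℕ) : ℝ) + x ^ 1 / (((0 + 1) * 1 : ℕ) : ℝ) +
        x ^ 2 / (((1 + 1) * ((0 + 1) * 1) : ℕ) : ℝ)) := by
      rw [hr_def]; push_cast; ring
    rw [e]
    refine hr.trans (le_of_eq ?_)
    norm_num
    ring
  set s := x ^ 2 / 2 + r with hs_def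
  have hx3 : |x| ^ 3 ≤ |x| ^ 2 / 4 := by nlinarith [sq_nonneg |x|]
  have hs : |s| ≤ |x| ^ 2 := by
    refine (abs_add_le _ _).trans ?_
    rw [abs_of_nonneg (by positivity : 0 ≤ x ^ 2 / 2), ← sq_abs x]
    nlinarith [sq_nonneg |x|]
  set y := q * (Real.exp x - 1) with hy_def
  have hys : y = q * (x + s) := by rw [hy_def, hs_def, hr_def]; ring
  have hxs : |x + s| ≤ 2 * |x| := by
    refine (abs_add_le _ _).trans ?_
    nlinarith
  have hy : |y| ≤ q * (2 * |x|) := by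
    rw [hys, abs_mul, abs_of_nonneg hq0]
    exact mul_le_mul_of_nonneg_left hxs hq0
  have hy' : |y| ≤ 1 / 2 := by nlinarith
  have hlog := Real.abs_log_sub_add_sum_range_le (x := -y) (by rw [abs_neg]; linarith) 2
  simp only [Finset.sum_range_succ, Finset.sum_range_zero, abs_neg, sub_neg_eq_add] at hlog
  have h1 : |y| ^ (2 + 1) / (1 - |y|) ≤ 16 * q * |x| ^ 3 := by
    rw [div_le_iff₀ (by linarith)]
    have h2 : |y| ^ 3 ≤ (q * (2 * |x|)) ^ 3 := pow_le_pow_left₀ (abs_nonneg _) hy 3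
    have h3 : (q * (2 * |x|)) ^ 3 ≤ 8 * q * |x| ^ 3 := by
      have : q ^ 3 ≤ q := by
        have := pow_le_of_le_one hq0 hq1 (n := 3) (by norm_num)
        exact this
      have := mul_le_mul_of_nonneg_right this (show 0 ≤ 8 * |x| ^ 3 by positivity)
      nlinarith
    have h4 : 16 * q * |x| ^ 3 * (1 / 2) ≤ 16 * q * |x| ^ 3 * (1 - |y|) :=
      mul_le_mul_of_nonneg_left (by linarith) (by positivity)
    norm_num
    linarith
  have h2 := hlog.trans h1
  have h3 : Real.log (1 + y) - (q * x + q * (1 - q) / 2 * x ^ 2) =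
      (0 + (-y) ^ (0 + 1) / (((0 : ℕ) : ℝ) + 1) + (-y) ^ (1 + 1) / (((1 : ℕ) : ℝ) + 1) +
        Real.log (1 + y)) + (q * r + -(q ^ 2 / 2 * (2 * x * s + s ^ 2))) := by
    have : q * r = q * s - q * x ^ 2 / 2 := by rw [hs_def]; ring
    rw [this, hys]
    push_cast
    ring
  rw [h3]
  refine (abs_add_le _ _).trans ?_
  have h4 : |q * r + -(q ^ 2 / 2 * (2 * x * s + s ^ 2))| ≤ 2 * q * |x| ^ 3 := by
    refine (abs_add_le _ _).trans ?_
    rw [abs_neg, abs_mul, abs_mul, abs_of_nonneg hq0, abs_of_nonneg (by positivity : 0 ≤ q ^ 2 / 2)]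
    have h5 : |2 * x * s + s ^ 2| ≤ 3 * |x| ^ 3 := by
      refine (abs_add_le _ _).trans ?_
      rw [abs_mul, abs_mul, abs_of_pos (two_pos : (0 : ℝ) < 2), abs_pow]
      have h6 : |s| ^ 2 ≤ |x| ^ 2 * |x| := by
        rw [sq]
        exact mul_le_mul hs (by nlinarith) (abs_nonneg _) (sq_nonneg _)
      have h7 := mul_le_mul_of_nonneg_left hs (show 0 ≤ 2 * |x| by positivity)
      nlinarith
    have h8 : q ^ 2 / 2 ≤ q / 2 := by nlinarith
    have h9 := mul_le_mul h8 h5 (abs_nonneg _) (by positivity)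
    have h10 := mul_le_mul_of_nonneg_left hr' hq0
    have h11 : 0 ≤ q * |x| ^ 3 := by positivity
    linarith
  linarith

section Moments

variable {Ω : Type*} [MeasurableSpace Ω] {P : Measure Ω} [IsProbabilityMeasure P] {N : ℕ} {q : ℝ}
  {ε : Fin N → Fin N → Ω → ℝ}

theorem IsDirectedErdosRenyi.ae_eq_zero_or_one (h : IsDirectedErdosRenyi P q ε) (hq0 : 0 ≤ q)
    (hq1 : q ≤ 1) (i j : Fin N) : ∀ᵐ ω ∂P, ε i j ω = 0 ∨ ε i j ω = 1 := by
  have hm0 : MeasurableSet {ω | ε i j ω = 0} := h.measurable i j (measurableSet_singleton 0)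
  have hm1 : MeasurableSet {ω | ε i j ω = 1} := h.measurable i j (measurableSet_singleton 1)
  have hd : Disjoint {ω | ε i j ω = 0} {ω | ε i j ω = 1} := by
    rw [Set.disjoint_left]
    intro ω h0 h1
    simp only [Set.mem_ofPred_eq] at h0 h1
    rw [h0] at h1
    exact zero_ne_one h1
  have hu := measure_union (μ := P) hd hm1
  rw [h.prob_one, h.prob_zero, ← ENNReal.ofReal_add (by linarith) hq0, sub_add_cancel,
    ENNReal.ofReal_one] at hu
  exact (prob_compl_eq_zero_iff (hm0.union hm1)).2 hu

theorem IsDirectedErdosRenyi.integral_exp_mul (h : IsDirectedErdosRenyi P q ε) (hq0 : 0 ≤ q)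
    (hq1 : q ≤ 1) (i j : Fin N) (t : ℝ) :
    ∫ ω, Real.exp (t * ε i j ω) ∂P = 1 + q * (Real.exp t - 1) := by
  have hm1 : MeasurableSet {ω | ε i j ω = 1} := h.measurable i j (measurableSet_singleton 1)
  have hae : (fun ω => Real.exp (t * ε i j ω)) =ᵐ[P]
      fun ω => 1 + {ω | ε i j ω = 1}.indicator (fun _ => Real.exp t - 1) ω := by
    filter_upwards [h.ae_eq_zero_or_one hq0 hq1 i j] with ω hω
    rcases hω with h0 | h0 <;> simp [Set.indicator, h0]
  rw [integral_congr_ae hae, integral_add (integrable_const _)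
    ((integrable_const _).indicator hm1), integral_indicator_const _ hm1, measureReal_def,
    h.prob_one, ENNReal.toReal_ofReal hq0]
  simp

theorem IsDirectedErdosRenyi.integral_exp_sum (h : IsDirectedErdosRenyi P q ε) (hq0 : 0 ≤ q)
    (hq1 : q ≤ 1) (t : Fin N → Fin N → ℝ) :
    ∫ ω, Real.exp (∑ i, ∑ j, t i j * ε i j ω) ∂P =
      ∏ e : Fin N × Fin N, (1 + q * (Real.exp (t e.1 e.2) - 1)) := by
  have hind : iIndepFun (fun (e : Fin N × Fin N) ω => Real.exp (t e.1 e.2 * ε e.1 e.2 ω)) P :=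
    h.indep.comp (fun e x => Real.exp (t e.1 e.2 * x)) fun e => by fun_prop
  have := hind.integral_fun_prod_eq_prod_integral fun e =>
    (by have := h.measurable e.1 e.2
        fun_prop : Measurable fun ω => Real.exp (t e.1 e.2 * ε e.1 e.2 ω)).aestronglyMeasurable
  simp_rw [h.integral_exp_mul hq0 hq1, ← Real.exp_sum, Fintype.sum_prod_type] at this
  exact this

theorem IsDirectedErdosRenyi.memLp_exp_sum (h : IsDirectedErdosRenyi P q ε) (hq0 : 0 ≤ q)
    (hq1 : q ≤ 1) (t : Fin N → Fin N → ℝ) :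
    MemLp (fun ω => Real.exp (∑ i, ∑ j, t i j * ε i j ω)) 2 P := by
  have hm := h.measurable
  refine MemLp.of_bound (by fun_prop) (Real.exp (∑ i, ∑ j, |t i j|)) ?_
  have hae : ∀ᵐ ω ∂P, ∀ i j, ε i j ω = 0 ∨ ε i j ω = 1 := by
    simp only [ae_all_iff]
    exact fun i j => h.ae_eq_zero_or_one hq0 hq1 i j
  filter_upwards [hae] with ω hω
  rw [Real.norm_eq_abs, abs_of_pos (Real.exp_pos _)]
  refine Real.exp_le_exp.2 (Finset.sum_le_sum fun i _ => Finset.sum_le_sum fun j _ => ?_)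
  rcases hω i j with h0 | h0 <;> rw [h0]
  · simp
  · simpa using le_abs_self _

/-- Exponential moments of the edge indicators up to third order. -/
theorem IsDirectedErdosRenyi.exists_integral_exp_sum_eq (h : IsDirectedErdosRenyi P q ε)
    (hq0 : 0 ≤ q) (hq1 : q ≤ 1) (t : Fin N → Fin N → ℝ) {T : ℝ} (hT : T ≤ 1 / 4)
    (ht : ∀ i j, |t i j| ≤ T) :
    ∃ d : ℝ, |d| ≤ 18 * q * N ^ 2 * T ^ 3 ∧
      ∫ ω, Real.exp (∑ i, ∑ j, t i j * ε i j ω) ∂P =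
        Real.exp (q * (∑ i, ∑ j, t i j) + q * (1 - q) / 2 * (∑ i, ∑ j, t i j ^ 2) + d) := by
  refine ⟨∑ e : Fin N × Fin N, (Real.log (1 + q * (Real.exp (t e.1 e.2) - 1)) -
    (q * t e.1 e.2 + q * (1 - q) / 2 * t e.1 e.2 ^ 2)), ?_, ?_⟩
  · refine (Finset.abs_sum_le_sum_abs _ _).trans ?_
    have : ∀ e : Fin N × Fin N, |Real.log (1 + q * (Real.exp (t e.1 e.2) - 1)) -
        (q * t e.1 e.2 + q * (1 - q) / 2 * t e.1 e.2 ^ 2)| ≤ 18 * q * T ^ 3 := by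
      intro e
      refine (abs_log_one_add_mul_exp_sub_one_le hq0 hq1 ((ht _ _).trans hT)).trans ?_
      exact mul_le_mul_of_nonneg_left (pow_le_pow_left₀ (abs_nonneg _) (ht _ _) 3) (by positivity)
    refine (Finset.sum_le_sum fun e _ => this e).trans (le_of_eq ?_)
    simp
    ring
  · rw [h.integral_exp_sum hq0 hq1]
    have hpos : ∀ e : Fin N × Fin N, 0 < 1 + q * (Real.exp (t e.1 e.2) - 1) := by
      intro e
      have := Real.exp_pos (t e.1 e.2)
      rcases hq1.eq_or_lt with h1 | h1
      · rw [h1]; linarith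
      · nlinarith [mul_nonneg hq0 this.le]
    have : ∏ e : Fin N × Fin N, (1 + q * (Real.exp (t e.1 e.2) - 1)) =
        Real.exp (∑ e : Fin N × Fin N, Real.log (1 + q * (Real.exp (t e.1 e.2) - 1))) := by
      rw [Real.exp_sum]
      exact Finset.prod_congr rfl fun e _ => (Real.exp_log (hpos e)).symm
    rw [this, Finset.sum_sub_distrib, Finset.sum_add_distrib, ← Finset.mul_sum, ← Finset.mul_sum,
      Fintype.sum_prod_type (fun e : Fin N × Fin N => t e.1 e.2),
      Fintype.sum_prod_type (fun e : Fin N × Fin N => t e.1 e.2 ^ 2)]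
    congr 1
    ring

end Moments

/-! ### Moments of the centred weights -/

/-- The Gibbs weight of the diluted model, with the products of spins centred at `m⁺(β)²`. -/
def centeredWeight (β q : ℝ) {N : ℕ} (e : Fin N → Fin N → ℝ) (σ : Config N) : ℝ :=
  Real.exp (∑ i, ∑ j, β / (2 * N * q) * (spin σ i * spin σ j - mPlus β ^ 2) * e i j)

/-- The factor introduced by the centring depends on the edges but not on the configuration, so it
cancels against the normalization. -/
theorem gibbs_eq (β q : ℝ) {N : ℕ} (e : Fin N → Fin N → ℝ) (σ : Config N) :
    gibbs β q 0 e σ = centeredWeight β q e σ / ∑ τ, centeredWeight β q e τ := by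
  have h : ∀ τ : Config N, Real.exp (-β * hamiltonian q 0 e τ) =
      Real.exp (∑ i, ∑ j, β / (2 * N * q) * mPlus β ^ 2 * e i j) * centeredWeight β q e τ := by
    intro τ
    unfold centeredWeight hamiltonian
    rw [← Real.exp_add, ← Finset.sum_add_distrib]
    congr 1
    rw [zero_mul, sub_zero, ← mul_assoc, Finset.mul_sum]
    refine Finset.sum_congr rfl fun i _ => ?_
    rw [← Finset.sum_add_distrib, Finset.mul_sum]
    refine Finset.sum_congr rfl fun j _ => ?_
    ring
  unfold gibbs partitionFunction
  simp_rw [h]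
  rw [← Finset.mul_sum, mul_div_mul_left _ _ (Real.exp_pos _).ne']

theorem sum_sum_spin {N : ℕ} (σ : Config N) (c : ℝ) :
    ∑ i, ∑ j, (spin σ i * spin σ j - c) = totalSpin σ ^ 2 - c * N ^ 2 := by
  simp only [Finset.sum_sub_distrib, ← Finset.mul_sum, ← Finset.sum_mul]
  simp [totalSpin]
  ring

/-- This is the quadratic form in the second cumulants. For `c = m²` it vanishes at `|totalSpin| = N
m`, `|overlap| = N m²`, which is what the centring is for; for `σ = τ` the overlap is `N`. -/
theorem sum_sum_spin_mul {N : ℕ} (σ τ : Config N) (c : ℝ) :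
    ∑ i, ∑ j, (spin σ i * spin σ j - c) * (spin τ i * spin τ j - c) =
      overlap σ τ ^ 2 - c * totalSpin σ ^ 2 - c * totalSpin τ ^ 2 + c ^ 2 * N ^ 2 := by
  have e : ∀ i j, (spin σ i * spin σ j - c) * (spin τ i * spin τ j - c) =
      (spin σ i * spin τ i) * (spin σ j * spin τ j) - c * (spin σ i * spin σ j - c)
        - c * (spin τ i * spin τ j - c) - c ^ 2 := fun i j => by ring
  simp only [e, Finset.sum_sub_distrib, ← Finset.mul_sum]
  simp only [← Finset.sum_mul]
  simp [overlap, totalSpin]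
  ring

theorem overlap_self {N : ℕ} (σ : Config N) : overlap σ σ = N := by
  simp [overlap, spin_mul_self]

theorem abs_sq_sub_sq_le {x m n : ℝ} (hx : |x| ≤ n) (hm0 : 0 ≤ m) (hm : m ≤ 1) (hn : 0 < n) :
    |x ^ 2 - m ^ 2 * n ^ 2| ≤ 2 * n * √n * (|(|x| - n * m)| / √n) := by
  have hs : √n ≠ 0 := (Real.sqrt_pos.2 hn).ne'
  have e : x ^ 2 - m ^ 2 * n ^ 2 = (|x| + n * m) * (|x| - n * m) := by
    rw [← sq_abs]; ring
  rw [e, abs_mul, abs_of_nonneg (by positivity : 0 ≤ |x| + n * m), mul_assoc, mul_div_cancel₀ _ hs]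
  exact mul_le_mul_of_nonneg_right (by nlinarith) (abs_nonneg _)

section Moments

variable {Ω : Type*} [MeasurableSpace Ω] {P : Measure Ω} [IsProbabilityMeasure P] {N : ℕ} {q : ℝ}
  {ε : Fin N → Fin N → Ω → ℝ}

/-- The common factor in the expectations of the centred weights. -/
def weightFactor (β q : ℝ) (N : ℕ) : ℝ :=
  Real.exp (-(q * (β / (2 * N * q)) * mPlus β ^ 2 * N ^ 2) +
    q * (1 - q) / 2 * (β / (2 * N * q)) ^ 2 * ((1 - mPlus β ^ 4) * N ^ 2))

theorem abs_centered_le {β : ℝ} (hβ : 1 < β) (σ : Config N) (i j : Fin N) :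
    |spin σ i * spin σ j - mPlus β ^ 2| ≤ 2 := by
  refine (abs_sub _ _).trans ?_
  have h0 := mPlus_pos hβ
  have h1 := mPlus_lt_one β
  rw [abs_mul, abs_spin, abs_spin, abs_of_nonneg (sq_nonneg _)]
  nlinarith

/-- The first cumulant supplies the Curie–Weiss exponent. In the second, `(1 - m⁴) N²` is
independent of `σ` and goes into `weightFactor`; the rest is a multiple of `M² - m² N²`. -/
theorem IsDirectedErdosRenyi.exists_integral_centeredWeight {β : ℝ} (hβ : 1 < β)
    (h : IsDirectedErdosRenyi P q ε) (hN : 0 < N) (hq0 : 0 < q) (hq1 : q ≤ 1)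
    (hγ : β / (2 * N * q) ≤ 1 / 16) (σ : Config N) :
    ∃ d : ℝ, |d| ≤ 18 * q * N ^ 2 * (2 * (β / (2 * N * q))) ^ 3 ∧
      ∫ ω, centeredWeight β q (fun i j => ε i j ω) σ ∂P =
        weightFactor β q N * curieWeissWeight β σ * Real.exp
          (-(q * (1 - q) * (β / (2 * N * q)) ^ 2 * mPlus β ^ 2 *
            (totalSpin σ ^ 2 - mPlus β ^ 2 * N ^ 2)) + d) := by
  have hN' : (0 : ℝ) < N := by exact_mod_cast hN
  have hγ0 : 0 ≤ β / (2 * N * q) := by positivity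
  have hqγ : q * (β / (2 * N * q)) = β / (2 * N) := by field_simp
  set γ := β / (2 * N * q) with hγ_def
  obtain ⟨d, hd, hint⟩ := h.exists_integral_exp_sum_eq hq0.le hq1
    (fun i j => γ * (spin σ i * spin σ j - mPlus β ^ 2)) (T := 2 * γ) (by linarith) (fun i j => by
      rw [abs_mul, abs_of_nonneg hγ0, mul_comm]
      exact mul_le_mul_of_nonneg_right (abs_centered_le hβ σ i j) hγ0)
  refine ⟨d, hd, hint.trans ?_⟩
  simp only [mul_pow, ← Finset.mul_sum, sum_sum_spin]
  have h2 := sum_sum_spin_mul σ σ (mPlus β ^ 2)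
  simp only [← sq, overlap_self] at h2
  rw [h2]
  unfold weightFactor curieWeissWeight
  rw [← Real.exp_add, ← Real.exp_add, ← hγ_def]
  congr 1
  have e : β * totalSpin σ ^ 2 / (2 * N) = q * γ * totalSpin σ ^ 2 := by rw [hqγ]; ring
  rw [e]
  ring

/-- Exponents add, so the only new contribution is the covariance of the two. The coefficient `2 m²`
collects one `m²` from each weight's own variance and one from the covariance. -/
theorem IsDirectedErdosRenyi.exists_integral_centeredWeight_mul {β : ℝ} (hβ : 1 < β)
    (h : IsDirectedErdosRenyi P q ε) (hN : 0 < N) (hq0 : 0 < q) (hq1 : q ≤ 1)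
    (hγ : β / (2 * N * q) ≤ 1 / 16) (σ τ : Config N) :
    ∃ d : ℝ, |d| ≤ 18 * q * N ^ 2 * (4 * (β / (2 * N * q))) ^ 3 ∧
      ∫ ω, centeredWeight β q (fun i j => ε i j ω) σ *
          centeredWeight β q (fun i j => ε i j ω) τ ∂P =
        weightFactor β q N * curieWeissWeight β σ * (weightFactor β q N * curieWeissWeight β τ) *
          Real.exp (q * (1 - q) * (β / (2 * N * q)) ^ 2 *
            ((overlap σ τ ^ 2 - (mPlus β ^ 2) ^ 2 * N ^ 2) -
              2 * mPlus β ^ 2 * (totalSpin σ ^ 2 - mPlus β ^ 2 * N ^ 2) -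
              2 * mPlus β ^ 2 * (totalSpin τ ^ 2 - mPlus β ^ 2 * N ^ 2)) + d) := by
  have hN' : (0 : ℝ) < N := by exact_mod_cast hN
  have hγ0 : 0 ≤ β / (2 * N * q) := by positivity
  have hqγ : q * (β / (2 * N * q)) = β / (2 * N) := by field_simp
  set γ := β / (2 * N * q) with hγ_def
  obtain ⟨d, hd, hint⟩ := h.exists_integral_exp_sum_eq hq0.le hq1
    (fun i j => γ * (spin σ i * spin σ j - mPlus β ^ 2) + γ * (spin τ i * spin τ j - mPlus β ^ 2))
    (T := 4 * γ) (by linarith) (fun i j => by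
      rw [← mul_add, abs_mul, abs_of_nonneg hγ0, mul_comm]
      refine mul_le_mul_of_nonneg_right ((abs_add_le _ _).trans ?_) hγ0
      linarith [abs_centered_le hβ σ i j, abs_centered_le hβ τ i j])
  refine ⟨d, hd, ?_⟩
  have hprod : ∀ ω, centeredWeight β q (fun i j => ε i j ω) σ *
      centeredWeight β q (fun i j => ε i j ω) τ = Real.exp (∑ i, ∑ j,
        (γ * (spin σ i * spin σ j - mPlus β ^ 2) + γ * (spin τ i * spin τ j - mPlus β ^ 2)) *
          ε i j ω) := by
    intro ω
    unfold centeredWeight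
    rw [← Real.exp_add, ← Finset.sum_add_distrib]
    congr 1
    refine Finset.sum_congr rfl fun i _ => ?_
    rw [← Finset.sum_add_distrib]
    refine Finset.sum_congr rfl fun j _ => ?_
    rw [← hγ_def]
    ring
  simp_rw [hprod]
  rw [hint]
  have hsq : ∀ i j, (γ * (spin σ i * spin σ j - mPlus β ^ 2) +
      γ * (spin τ i * spin τ j - mPlus β ^ 2)) ^ 2 =
      γ ^ 2 * ((spin σ i * spin σ j - mPlus β ^ 2) * (spin σ i * spin σ j - mPlus β ^ 2)) +
      γ ^ 2 * ((spin τ i * spin τ j - mPlus β ^ 2) * (spin τ i * spin τ j - mPlus β ^ 2)) +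
      2 * γ ^ 2 * ((spin σ i * spin σ j - mPlus β ^ 2) * (spin τ i * spin τ j - mPlus β ^ 2)) :=
    fun i j => by ring
  simp only [hsq, Finset.sum_add_distrib, ← Finset.mul_sum, sum_sum_spin, sum_sum_spin_mul,
    overlap_self]
  unfold weightFactor curieWeissWeight
  simp only [← Real.exp_add, ← hγ_def]
  congr 1
  have e : ∀ σ : Config N, β * totalSpin σ ^ 2 / (2 * N) = q * γ * totalSpin σ ^ 2 := by
    intro σ
    rw [hqγ]; ring
  rw [e, e]
  ring

/-- Rate of the error terms in the moments of the centred weights. -/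
def errorRate (β q : ℝ) (N : ℕ) : ℝ := (β ^ 2 + 144 * β ^ 3) / (q * √(N : ℝ))

/-- The second and third cumulants have orders `1 / (q √N)` and `1 / (q √N)²`; smallness of
`errorRate` gives `q √N ≥ 1`, so the first power bounds both. The trailing factor `2` allows for the
coefficient `2 m² ≤ 2`. -/
theorem errorRate_aux {β : ℝ} (hβ : 1 < β) (hN : 0 < N) (hq0 : 0 < q) (hq1 : q ≤ 1)
    (hsmall : errorRate β q N ≤ 1) :
    β / (2 * N * q) ≤ 1 / 16 ∧
    q * (1 - q) * (β / (2 * N * q)) ^ 2 * (2 * N * √(N : ℝ)) * 2 ≤ β ^ 2 / (q * √(N : ℝ)) ∧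
    18 * q * N ^ 2 * (4 * (β / (2 * N * q))) ^ 3 ≤ 144 * β ^ 3 / (q * √(N : ℝ)) := by
  have hN' : (0 : ℝ) < N := by exact_mod_cast hN
  have hN1 : (1 : ℝ) ≤ N := by exact_mod_cast hN
  set r := √(N : ℝ) with hr
  have hr0 : 0 < r := Real.sqrt_pos.2 hN'
  have hr1 : 1 ≤ r := Real.one_le_sqrt.2 hN1
  have hrr : (N : ℝ) = r ^ 2 := (Real.sq_sqrt hN'.le).symm
  unfold errorRate at hsmall
  rw [div_le_one (by positivity)] at hsmall
  have hβ2 : 1 ≤ β ^ 2 := by nlinarith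
  have h1 : 144 * β ≤ q * r := by nlinarith
  have h2 : 1 ≤ q * r := by nlinarith
  rw [hrr]
  refine ⟨?_, ?_, ?_⟩
  · rw [div_le_iff₀ (by positivity)]
    nlinarith
  · have e : q * (1 - q) * (β / (2 * r ^ 2 * q)) ^ 2 * (2 * r ^ 2 * r) * 2 =
        (1 - q) * (β ^ 2 / (q * r)) := by
      field_simp
    rw [e]
    have : 0 ≤ β ^ 2 / (q * r) := by positivity
    nlinarith
  · have e : 18 * q * (r ^ 2) ^ 2 * (4 * (β / (2 * r ^ 2 * q))) ^ 3 =
        144 * β ^ 3 / (q * r) * (1 / (q * r)) := by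
      field_simp
      ring
    rw [e]
    have : 0 ≤ 144 * β ^ 3 / (q * r) := by positivity
    have h3 : 1 / (q * r) ≤ 1 := by rw [div_le_one (by positivity)]; exact h2
    nlinarith

theorem spinDeviation_nonneg (β : ℝ) (σ : Config N) : 0 ≤ spinDeviation β σ := by
  unfold spinDeviation; positivity

theorem overlapDeviation_nonneg (β : ℝ) (σ τ : Config N) : 0 ≤ overlapDeviation β σ τ := by
  unfold overlapDeviation; positivity

theorem abs_totalSpin_sq_sub_le {β : ℝ} (hβ : 1 < β) (hN : 0 < N) (σ : Config N) :
    |totalSpin σ ^ 2 - mPlus β ^ 2 * N ^ 2| ≤ 2 * N * √(N : ℝ) * spinDeviation β σ :=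
  abs_sq_sub_sq_le (abs_totalSpin_le σ) (mPlus_pos hβ).le (mPlus_lt_one β).le
    (by exact_mod_cast hN)

theorem mPlus_sq_le_one {β : ℝ} (hβ : 1 < β) : mPlus β ^ 2 ≤ 1 :=
  pow_le_one₀ (mPlus_pos hβ).le (mPlus_lt_one β).le

theorem abs_overlap_sq_sub_le {β : ℝ} (hβ : 1 < β) (hN : 0 < N) (σ τ : Config N) :
    |overlap σ τ ^ 2 - (mPlus β ^ 2) ^ 2 * N ^ 2| ≤
      2 * N * √(N : ℝ) * overlapDeviation β σ τ :=
  abs_sq_sub_sq_le (abs_overlap_le σ τ) (sq_nonneg _) (mPlus_sq_le_one hβ) (by exact_mod_cast hN)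

/-- A sum of three numbers is at most three times the largest. Each deviation can then be treated
separately, without joint exponential moments. -/
theorem exp_one_add_le (x y z : ℝ) :
    Real.exp (1 + x + y + z) ≤
      Real.exp 1 * (Real.exp (3 * x) + Real.exp (3 * y) + Real.exp (3 * z)) := by
  have h : Real.exp (1 + x + y + z) = Real.exp 1 * Real.exp (x + y + z) := by
    rw [← Real.exp_add]; congr 1; ring
  rw [h]
  refine mul_le_mul_of_nonneg_left ?_ (Real.exp_pos 1).le
  have h1 := Real.exp_pos (3 * x)
  have h2 := Real.exp_pos (3 * y)
  have h3 := Real.exp_pos (3 * z)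
  rcases le_total x y with a | a <;> rcases le_total y z with b | b <;>
    rcases le_total x z with c | c
  all_goals
    first
    | linarith [Real.exp_le_exp.2 (show x + y + z ≤ 3 * x by linarith)]
    | linarith [Real.exp_le_exp.2 (show x + y + z ≤ 3 * y by linarith)]
    | linarith [Real.exp_le_exp.2 (show x + y + z ≤ 3 * z by linarith)]

theorem IsDirectedErdosRenyi.abs_integral_centeredWeight_sub_le {β : ℝ} (hβ : 1 < β)
    (h : IsDirectedErdosRenyi P q ε) (hN : 0 < N) (hq0 : 0 < q) (hq1 : q ≤ 1)
    (hsmall : errorRate β q N ≤ 1) (σ : Config N) :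
    |∫ ω, centeredWeight β q (fun i j => ε i j ω) σ ∂P -
        weightFactor β q N * curieWeissWeight β σ| ≤
      errorRate β q N * Real.exp 1 * (weightFactor β q N * (curieWeissWeight β σ *
        (3 * Real.exp (3 * spinDeviation β σ)))) := by
  obtain ⟨hγ, hA, hB⟩ := errorRate_aux hβ hN hq0 hq1 hsmall
  obtain ⟨d, hd, hint⟩ := h.exists_integral_centeredWeight hβ hN hq0 hq1 hγ σ
  have hN' : (0 : ℝ) < N := by exact_mod_cast hN
  have hκ : 0 < weightFactor β q N := Real.exp_pos _
  have hu := curieWeissWeight_pos β σ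
  have hY := spinDeviation_nonneg β σ
  rw [hint]
  set D := -(q * (1 - q) * (β / (2 * N * q)) ^ 2 * mPlus β ^ 2 *
            (totalSpin σ ^ 2 - mPlus β ^ 2 * N ^ 2)) + d with hD
  have hε0 : 0 ≤ errorRate β q N := by unfold errorRate; positivity
  -- The deviation is written three times to match the shape of `exp_one_add_le`, so both moments
  -- use the same exponent `3`.
  have hDle : |D| ≤ errorRate β q N *
      (1 + spinDeviation β σ + spinDeviation β σ + spinDeviation β σ) := by
    have hc : 0 ≤ q * (1 - q) * (β / (2 * N * q)) ^ 2 :=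
      mul_nonneg (mul_nonneg hq0.le (by linarith)) (sq_nonneg _)
    have h1 := abs_totalSpin_sq_sub_le hβ hN σ
    have hγ0 : 0 ≤ β / (2 * N * q) := by positivity
    have h2 : |d| ≤ 144 * β ^ 3 / (q * √(N : ℝ)) := by
      refine hd.trans (le_trans ?_ hB)
      refine mul_le_mul_of_nonneg_left (pow_le_pow_left₀ (by positivity) (by linarith) 3)
        (by positivity)
    have h3 : q * (1 - q) * (β / (2 * N * q)) ^ 2 * mPlus β ^ 2 *
        |totalSpin σ ^ 2 - mPlus β ^ 2 * N ^ 2| ≤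
        q * (1 - q) * (β / (2 * N * q)) ^ 2 * 1 * (2 * N * √(N : ℝ) * spinDeviation β σ) :=
      mul_le_mul (mul_le_mul_of_nonneg_left (mPlus_sq_le_one hβ) hc) h1 (abs_nonneg _)
        (by positivity)
    have h4 := mul_le_mul_of_nonneg_right hA hY
    have h5 : 0 ≤ q * (1 - q) * (β / (2 * N * q)) ^ 2 * (2 * N * √(N : ℝ) * spinDeviation β σ) := by
      positivity
    have h6 : |D| ≤ q * (1 - q) * (β / (2 * N * q)) ^ 2 * mPlus β ^ 2 *
        |totalSpin σ ^ 2 - mPlus β ^ 2 * N ^ 2| + |d| := by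
      refine (abs_add_le _ _).trans ?_
      rw [abs_neg, abs_mul, abs_of_nonneg (by positivity :
        0 ≤ q * (1 - q) * (β / (2 * N * q)) ^ 2 * mPlus β ^ 2)]
    have h7 : errorRate β q N = β ^ 2 / (q * √(N : ℝ)) + 144 * β ^ 3 / (q * √(N : ℝ)) := by
      unfold errorRate; rw [add_div]
    have h8 : 0 ≤ β ^ 2 / (q * √(N : ℝ)) := by positivity
    have h9 : 0 ≤ 144 * β ^ 3 / (q * √(N : ℝ)) := by positivity
    rw [h7]
    nlinarith [mul_nonneg h8 hY, mul_nonneg h9 hY]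
  have h1 := abs_exp_sub_one_le hsmall hε0 hDle
  have h2 := exp_one_add_le (spinDeviation β σ) (spinDeviation β σ) (spinDeviation β σ)
  have e : weightFactor β q N * curieWeissWeight β σ * Real.exp D -
      weightFactor β q N * curieWeissWeight β σ =
      weightFactor β q N * curieWeissWeight β σ * (Real.exp D - 1) := by ring
  rw [e, abs_mul, abs_of_pos (mul_pos hκ hu)]
  refine (mul_le_mul_of_nonneg_left (h1.trans (mul_le_mul_of_nonneg_left h2 hε0))
    (mul_pos hκ hu).le).trans (le_of_eq (by ring))

theorem IsDirectedErdosRenyi.abs_integral_centeredWeight_mul_sub_le {β : ℝ} (hβ : 1 < β)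
    (h : IsDirectedErdosRenyi P q ε) (hN : 0 < N) (hq0 : 0 < q) (hq1 : q ≤ 1)
    (hsmall : errorRate β q N ≤ 1) (σ τ : Config N) :
    |∫ ω, centeredWeight β q (fun i j => ε i j ω) σ *
          centeredWeight β q (fun i j => ε i j ω) τ ∂P -
        weightFactor β q N * curieWeissWeight β σ * (weightFactor β q N * curieWeissWeight β τ)| ≤
      errorRate β q N * Real.exp 1 * (weightFactor β q N ^ 2 *
        (curieWeissWeight β σ * curieWeissWeight β τ * (Real.exp (3 * overlapDeviation β σ τ) +
          Real.exp (3 * spinDeviation β σ) + Real.exp (3 * spinDeviation β τ)))) := by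
  obtain ⟨hγ, hA, hB⟩ := errorRate_aux hβ hN hq0 hq1 hsmall
  obtain ⟨d, hd, hint⟩ := h.exists_integral_centeredWeight_mul hβ hN hq0 hq1 hγ σ τ
  have hN' : (0 : ℝ) < N := by exact_mod_cast hN
  have hκ : 0 < weightFactor β q N := Real.exp_pos _
  have hu := curieWeissWeight_pos β σ
  have hv := curieWeissWeight_pos β τ
  have hX := overlapDeviation_nonneg β σ τ
  have hY := spinDeviation_nonneg β σ
  have hZ := spinDeviation_nonneg β τ
  rw [hint]
  set c := q * (1 - q) * (β / (2 * N * q)) ^ 2 with hc_def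
  set D := c * ((overlap σ τ ^ 2 - (mPlus β ^ 2) ^ 2 * N ^ 2) -
              2 * mPlus β ^ 2 * (totalSpin σ ^ 2 - mPlus β ^ 2 * N ^ 2) -
              2 * mPlus β ^ 2 * (totalSpin τ ^ 2 - mPlus β ^ 2 * N ^ 2)) + d with hD
  have hε0 : 0 ≤ errorRate β q N := by unfold errorRate; positivity
  have hDle : |D| ≤ errorRate β q N *
      (1 + overlapDeviation β σ τ + spinDeviation β σ + spinDeviation β τ) := by
    have hc : 0 ≤ c := mul_nonneg (mul_nonneg hq0.le (by linarith)) (sq_nonneg _)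
    set S := 2 * N * √(N : ℝ) with hS
    have hS0 : 0 ≤ S := by positivity
    have spin_bound : ∀ σ : Config N, |2 * mPlus β ^ 2 * (totalSpin σ ^ 2 - mPlus β ^ 2 * N ^ 2)| ≤
        2 * (S * spinDeviation β σ) := by
      intro σ
      have h1 := abs_totalSpin_sq_sub_le hβ hN σ
      rw [abs_mul, abs_of_nonneg (by positivity : 0 ≤ 2 * mPlus β ^ 2)]
      exact mul_le_mul (by linarith [mPlus_sq_le_one hβ]) h1 (abs_nonneg _) zero_le_two
    have h1 := abs_overlap_sq_sub_le hβ hN σ τ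
    have h2 := spin_bound σ
    have h3 := spin_bound τ
    have h4 : |(overlap σ τ ^ 2 - (mPlus β ^ 2) ^ 2 * N ^ 2) -
              2 * mPlus β ^ 2 * (totalSpin σ ^ 2 - mPlus β ^ 2 * N ^ 2) -
              2 * mPlus β ^ 2 * (totalSpin τ ^ 2 - mPlus β ^ 2 * N ^ 2)| ≤
        S * 2 * (overlapDeviation β σ τ + spinDeviation β σ + spinDeviation β τ) := by
      refine (abs_sub _ _).trans ((add_le_add_left (abs_sub _ _) _).trans ?_)
      nlinarith [mul_nonneg hS0 hX]
    have h5 : |D| ≤ c * (S * 2 *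
        (overlapDeviation β σ τ + spinDeviation β σ + spinDeviation β τ)) +
        144 * β ^ 3 / (q * √(N : ℝ)) := by
      refine (abs_add_le _ _).trans (add_le_add ?_ (hd.trans hB))
      rw [abs_mul, abs_of_nonneg hc]
      exact mul_le_mul_of_nonneg_left h4 hc
    have hsum : 0 ≤ overlapDeviation β σ τ + spinDeviation β σ + spinDeviation β τ := by positivity
    have h6 := mul_le_mul_of_nonneg_right hA hsum
    have h7 : errorRate β q N = β ^ 2 / (q * √(N : ℝ)) + 144 * β ^ 3 / (q * √(N : ℝ)) := by
      unfold errorRate; rw [add_div]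
    have h8 : 0 ≤ β ^ 2 / (q * √(N : ℝ)) := by positivity
    have h9 : 0 ≤ 144 * β ^ 3 / (q * √(N : ℝ)) := by positivity
    rw [h7]
    nlinarith [mul_nonneg h9 hsum]
  have h1 := abs_exp_sub_one_le hsmall hε0 hDle
  have h2 := exp_one_add_le (overlapDeviation β σ τ) (spinDeviation β σ) (spinDeviation β τ)
  have hpos : 0 < weightFactor β q N * curieWeissWeight β σ *
      (weightFactor β q N * curieWeissWeight β τ) := by positivity
  rw [← mul_sub_one, abs_mul, abs_of_pos hpos]
  refine (mul_le_mul_of_nonneg_left (h1.trans (mul_le_mul_of_nonneg_left h2 hε0))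
    hpos.le).trans (le_of_eq (by ring))

end Moments

/-- The first two moments of the centred weights are asymptotically those of the Curie–Weiss
weights. -/
theorem exists_moments_le {β : ℝ} (hβ : 1 < β) : ∃ C : ℝ, 0 < C ∧ ∀ᶠ N : ℕ in atTop,
    ∀ q : ℝ, 0 < q → q ≤ 1 → errorRate β q N ≤ 1 →
    ∀ {Ω : Type*} [MeasurableSpace Ω] (P : Measure Ω) [IsProbabilityMeasure P]
      (ε : Fin N → Fin N → Ω → ℝ), IsDirectedErdosRenyi P q ε →
      (∑ σ, |∫ ω, centeredWeight β q (fun i j => ε i j ω) σ ∂P -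
          weightFactor β q N * curieWeissWeight β σ| ≤
        C * errorRate β q N * (weightFactor β q N * ∑ σ : Config N, curieWeissWeight β σ)) ∧
      (∑ σ, ∑ τ, |∫ ω, centeredWeight β q (fun i j => ε i j ω) σ *
            centeredWeight β q (fun i j => ε i j ω) τ ∂P -
          weightFactor β q N * curieWeissWeight β σ *
            (weightFactor β q N * curieWeissWeight β τ)| ≤
        C * errorRate β q N *
          (weightFactor β q N * ∑ σ : Config N, curieWeissWeight β σ) ^ 2) := by
  obtain ⟨C₁, hC₁, h₁⟩ := exists_sum_curieWeissWeight_mul_exp_le hβ (a := 3) (by norm_num)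
  obtain ⟨C₂, hC₂, h₂⟩ := exists_sum_curieWeissWeight_mul_exp_overlap_le hβ (a := 3) (by norm_num)
  -- The first moment needs `3 * C₁`, the second `C₂ + 2 * C₁`: one overlap term and two
  -- magnetization terms.
  refine ⟨Real.exp 1 * (3 * C₁ + C₂), by positivity, ?_⟩
  filter_upwards [h₁, h₂, eventually_gt_atTop 0] with N h₁ h₂ hN q hq0 hq1 hsmall Ω _ P _ ε hε
  have hε0 : 0 ≤ errorRate β q N := by unfold errorRate; positivity
  have hκ : 0 < weightFactor β q N := Real.exp_pos _
  have hU := sum_curieWeissWeight_pos β N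
  set U := ∑ σ : Config N, curieWeissWeight β σ with hU_def
  constructor
  · refine (Finset.sum_le_sum fun σ _ =>
      hε.abs_integral_centeredWeight_sub_le hβ hN hq0 hq1 hsmall σ).trans ?_
    have e : ∀ σ : Config N, errorRate β q N * Real.exp 1 * (weightFactor β q N *
        (curieWeissWeight β σ * (3 * Real.exp (3 * spinDeviation β σ)))) =
        errorRate β q N * Real.exp 1 * weightFactor β q N * 3 *
        (curieWeissWeight β σ * Real.exp (3 * spinDeviation β σ)) := fun σ => by ring
    simp_rw [e]
    rw [← Finset.mul_sum]
    refine (mul_le_mul_of_nonneg_left h₁ (by positivity)).trans ?_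
    have : 0 ≤ errorRate β q N * Real.exp 1 * weightFactor β q N * (C₂ * U) := by positivity
    linarith
  · refine (Finset.sum_le_sum fun σ _ => Finset.sum_le_sum fun τ _ =>
      hε.abs_integral_centeredWeight_mul_sub_le hβ hN hq0 hq1 hsmall σ τ).trans ?_
    simp only [← Finset.mul_sum, mul_add, Finset.sum_add_distrib]
    have e1 : ∑ σ : Config N, ∑ τ : Config N, curieWeissWeight β σ * curieWeissWeight β τ *
        Real.exp (3 * spinDeviation β σ) ≤ C₁ * U * U := by
      refine le_trans (le_of_eq ?_) (mul_le_mul_of_nonneg_right h₁ hU.le)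
      rw [hU_def, Finset.sum_mul_sum]
      exact Finset.sum_congr rfl fun σ _ => Finset.sum_congr rfl fun τ _ => by ring
    have e2 : ∑ σ : Config N, ∑ τ : Config N, curieWeissWeight β σ * curieWeissWeight β τ *
        Real.exp (3 * spinDeviation β τ) ≤ U * (C₁ * U) := by
      refine le_trans (le_of_eq ?_) (mul_le_mul_of_nonneg_left h₁ hU.le)
      rw [hU_def, Finset.sum_mul_sum]
      exact Finset.sum_congr rfl fun σ _ => Finset.sum_congr rfl fun τ _ => by ring
    have e3 := add_le_add (add_le_add h₂ e1) e2
    rw [← mul_add, ← mul_add, ← mul_add, ← mul_add]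
    refine (mul_le_mul_of_nonneg_left (mul_le_mul_of_nonneg_left e3 (by positivity))
      (by positivity : 0 ≤ errorRate β q N * Real.exp 1)).trans ?_
    have : 0 ≤ errorRate β q N * Real.exp 1 * weightFactor β q N ^ 2 * (C₁ * U ^ 2) := by positivity
    linarith

/-! ### Laplace asymptotics on the half line -/

/-- The half line part of the Laplace integral, tilted by a character. -/
def laplaceIntegral (β t : ℝ) (N : ℕ) : ℂ :=
  ∫ x in Set.Ioi (0 : ℝ), (Real.exp (N * pressure β x) : ℂ) *
    Complex.exp (t * √(N : ℝ) * (x - mPlus β) * Complex.I)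

theorem laplaceIntegral_rescale (β t : ℝ) {N : ℕ} (hN : 0 < N) :
    (√(N : ℝ) : ℂ) * Real.exp (-(N * pressure β (mPlus β))) * laplaceIntegral β t N =
      ∫ z : ℝ, (Set.Ioi (0 : ℝ)).indicator (fun _ =>
        (Real.exp (N * (pressure β (mPlus β + z / √(N : ℝ)) - pressure β (mPlus β))) : ℂ) *
          Complex.exp (t * z * Complex.I)) (mPlus β + z / √(N : ℝ)) := by
  have hN' : (0 : ℝ) < N := by exact_mod_cast hN
  have hs : 0 < √(N : ℝ) := Real.sqrt_pos.2 hN'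
  set m := mPlus β
  set G : ℝ → ℂ := fun x => (Set.Ioi (0 : ℝ)).indicator (fun x =>
    (Real.exp (N * (pressure β x - pressure β m)) : ℂ) *
      Complex.exp (t * √(N : ℝ) * (x - m) * Complex.I)) x with hG
  have h1 : (Real.exp (-(N * pressure β m)) : ℂ) * laplaceIntegral β t N = ∫ x, G x := by
    unfold laplaceIntegral
    rw [hG, integral_indicator measurableSet_Ioi, ← integral_const_mul]
    congr 1
    ext x
    rw [← mul_assoc, ← Complex.ofReal_mul, ← Real.exp_add]
    congr 3
    ring
  rw [mul_assoc, h1, ← integral_add_left_eq_self G m]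
  have h2 := Measure.integral_comp_div (fun z => G (m + z)) (√(N : ℝ))
  rw [abs_of_pos hs, Complex.real_smul] at h2
  rw [← h2]
  congr 1
  ext z
  simp only [hG, Set.indicator]
  congr 2
  push_cast
  congr 1
  have : (√(N : ℝ) : ℂ) ≠ 0 := by exact_mod_cast hs.ne'
  field_simp
  ring

/-- Laplace's method: after `x = m + z / √N` the integrand converges to a Gaussian times a
character. On `x > 0` the global bound of `exists_pressure_le` provides the majorant `exp (-κ z²)`.
-/
theorem tendsto_laplaceIntegral {β : ℝ} (hβ : 1 < β) (t : ℝ) :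
    Tendsto (fun N : ℕ => (√(N : ℝ) : ℂ) * Real.exp (-(N * pressure β (mPlus β))) *
      laplaceIntegral β t N) atTop
      (𝓝 (√(2 * Real.pi / curvature β) * Real.exp (-(t ^ 2 / (2 * curvature β))) : ℂ)) := by
  obtain ⟨κ, hκ, hle⟩ := exists_pressure_le hβ
  have hm := mPlus_pos hβ
  have hcurv := curvature_pos hβ
  have hval : ∫ z : ℝ, (Real.exp (-(curvature β / 2) * z ^ 2) : ℂ) * Complex.exp (t * z * Complex.I)
      = (√(2 * Real.pi / curvature β) * Real.exp (-(t ^ 2 / (2 * curvature β))) : ℂ) := by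
    -- With one spin, zero magnetization and `curvature β` as inverse temperature, the
    -- Hubbard–Stratonovich integral is the Fourier transform needed here.
    have h := integral_cexp_mul_spin hcurv one_pos 0 t
    simp only [Nat.cast_one, one_mul, Complex.ofReal_zero, mul_zero, zero_add, zero_div,
      zero_mul, Complex.exp_zero, ne_eq, OfNat.ofNat_ne_zero, not_false_eq_true, zero_pow,
      Real.exp_zero, Complex.ofReal_one, mul_one] at h
    rw [← h]
    congr 1
    ext z
    push_cast
    rw [← Complex.exp_add]
    congr 1
    ring
  rw [← hval]
  refine Tendsto.congr' (f₁ := fun N : ℕ => ∫ z : ℝ, (Set.Ioi (0 : ℝ)).indicator (fun _ =>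
        (Real.exp (N * (pressure β (mPlus β + z / √(N : ℝ)) - pressure β (mPlus β))) : ℂ) *
          Complex.exp (t * z * Complex.I)) (mPlus β + z / √(N : ℝ)))
    (by
      filter_upwards [eventually_gt_atTop 0] with N hN
      exact (laplaceIntegral_rescale β t hN).symm) ?_
  refine tendsto_integral_filter_of_dominated_convergence (fun z => Real.exp (-κ * z ^ 2)) ?_ ?_
    (integrable_exp_neg_mul_sq hκ) ?_
  · refine Eventually.of_forall fun N => Measurable.aestronglyMeasurable ?_
    have hc := continuous_pressure β
    have hset : MeasurableSet {z : ℝ | mPlus β + z / √(N : ℝ) ∈ Set.Ioi (0 : ℝ)} :=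
      (by fun_prop : Measurable fun z : ℝ => mPlus β + z / √(N : ℝ)) measurableSet_Ioi
    exact Measurable.indicator (s := {z : ℝ | mPlus β + z / √(N : ℝ) ∈ Set.Ioi (0 : ℝ)})
      (f := fun z : ℝ =>
        (Real.exp (N * (pressure β (mPlus β + z / √(N : ℝ)) - pressure β (mPlus β))) : ℂ) *
          Complex.exp (t * z * Complex.I))
      (Continuous.measurable (by fun_prop)) hset
  · filter_upwards [eventually_gt_atTop 0] with N hN
    have hN' : (0 : ℝ) < N := by exact_mod_cast hN
    refine ae_of_all _ fun z => ?_
    by_cases hz : mPlus β + z / √(N : ℝ) ∈ Set.Ioi (0 : ℝ)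
    · rw [Set.indicator_of_mem hz, norm_mul, ← Complex.ofReal_mul, Complex.norm_exp_ofReal_mul_I,
        mul_one, Complex.norm_real, Real.norm_eq_abs, abs_of_pos (Real.exp_pos _)]
      refine Real.exp_le_exp.2 ?_
      have h1 := hle (mPlus β + z / √(N : ℝ))
      rw [abs_of_pos hz, add_sub_cancel_left, div_pow, Real.sq_sqrt hN'.le] at h1
      have h2 := mul_le_mul_of_nonneg_left h1 hN'.le
      have h3 : N * (κ * (z ^ 2 / N)) = κ * z ^ 2 := by field_simp
      nlinarith
    · rw [Set.indicator_of_notMem hz, norm_zero]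
      positivity
  · refine ae_of_all _ fun z => ?_
    have h1 : Tendsto (fun N : ℕ => mPlus β + z / √(N : ℝ)) atTop (𝓝 (mPlus β)) := by
      simpa using (tendsto_const_nhds (x := mPlus β)).add
        (tendsto_const_nhds (x := z).div_atTop tendsto_sqrt_natCast)
    have h2 : Tendsto (fun N : ℕ =>
        (Real.exp (N * (pressure β (mPlus β + z / √(N : ℝ)) - pressure β (mPlus β))) : ℂ) *
          Complex.exp (t * z * Complex.I)) atTop
        (𝓝 ((Real.exp (-(curvature β / 2) * z ^ 2) : ℂ) * Complex.exp (t * z * Complex.I))) :=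
      ((Complex.continuous_ofReal.tendsto _).comp
        ((Real.continuous_exp.tendsto _).comp (tendsto_mul_pressure_sub z))).mul_const _
    refine h2.congr' ?_
    filter_upwards [h1.eventually (lt_mem_nhds hm)] with N hN
    rw [Set.indicator_of_mem (show mPlus β + z / √(N : ℝ) ∈ Set.Ioi (0 : ℝ) from hN)]

theorem integrable_exp_pressure {β : ℝ} (hβ : 1 < β) {N : ℕ} (hN : 0 < N) :
    Integrable fun x => Real.exp (N * pressure β x) := by
  obtain ⟨C, -, h⟩ := exists_integral_exp_pressure_le hβ 0
  simpa using (h N hN).1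

theorem integral_exp_pressure {β : ℝ} (hβ : 1 < β) {N : ℕ} (hN : 0 < N) :
    ((∫ x, Real.exp (N * pressure β x) : ℝ) : ℂ) = 2 * laplaceIntegral β 0 N := by
  have hi := integrable_exp_pressure hβ hN
  have h1 : laplaceIntegral β 0 N =
      ((∫ x in Set.Ioi (0 : ℝ), Real.exp (N * pressure β x) : ℝ) : ℂ) := by
    rw [← integral_complex_ofReal]
    unfold laplaceIntegral
    simp
  have h2 : ∫ x in Set.Iic (0 : ℝ), Real.exp (N * pressure β x) =
      ∫ x in Set.Ioi (0 : ℝ), Real.exp (N * pressure β x) := by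
    have := integral_comp_neg_Iic (0 : ℝ) (fun x => Real.exp (N * pressure β x))
    simp only [pressure_neg, neg_zero] at this
    exact this
  rw [h1, ← intervalIntegral.integral_Iic_add_Ioi hi.integrableOn hi.integrableOn, h2]
  push_cast
  ring

/-- The partition function of the Curie–Weiss model is exponentially large compared with the
number of configurations. -/
theorem two_pow_div_sum_curieWeissWeight_le {β : ℝ} (hβ : 1 < β) {N : ℕ} (hN : 0 < N) :
    2 ^ N / ∑ σ : Config N, curieWeissWeight β σ ≤ Real.exp (-(N * pressure β (mPlus β))) := by
  have hN' : (0 : ℝ) < N := by exact_mod_cast hN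
  have hK : 0 < √(2 * Real.pi / (N * β)) := by
    have := Real.pi_pos
    positivity
  rw [div_le_iff₀ (sum_curieWeissWeight_pos β N)]
  refine le_of_mul_le_mul_left ?_ hK
  rw [mul_left_comm, sum_curieWeissWeight (by linarith) hN]
  have h := mul_le_mul_of_nonneg_left (integral_exp_pressure_ge (by linarith) hN (integrable_exp_pressure hβ hN))
    (show 0 ≤ Real.exp (-(N * pressure β (mPlus β))) * 2 ^ N by positivity)
  have e : Real.exp (-(N * pressure β (mPlus β))) * 2 ^ N *
      (Real.exp (N * pressure β (mPlus β)) * √(2 * Real.pi / (N * β))) =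
      √(2 * Real.pi / (N * β)) * 2 ^ N := by
    rw [Real.exp_neg]
    field_simp
  linarith

theorem tendsto_exp_neg_mul_pressure {β : ℝ} (hβ : 1 < β) :
    Tendsto (fun N : ℕ => Real.exp (-(N * pressure β (mPlus β)))) atTop (𝓝 0) :=
  Real.tendsto_exp_neg_atTop_nhds_zero.comp
    (tendsto_natCast_atTop_atTop.atTop_mul_const (pressure_mPlus_pos hβ))

/-! ### Fourier modes of the magnetization -/

/-- The fluctuation `(M - N m⁺(β)) / √N` of the magnetization. -/
def fluctuation (β : ℝ) {N : ℕ} (σ : Config N) : ℝ := (totalSpin σ - N * mPlus β) / √(N : ℝ)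

/-- The integrand of the Hubbard–Stratonovich representation of one Fourier mode. -/
def spinMode (β t : ℝ) {N : ℕ} (σ : Config N) (x : ℝ) : ℂ :=
  (Real.exp (-(N * β / 2) * x ^ 2 + β * totalSpin σ * x) : ℂ) *
    Complex.exp (t * √(N : ℝ) * (x - mPlus β) * Complex.I)

theorem norm_spinMode (β t : ℝ) {N : ℕ} (σ : Config N) (x : ℝ) :
    ‖spinMode β t σ x‖ = Real.exp (-(N * β / 2) * x ^ 2 + β * totalSpin σ * x) := by
  unfold spinMode
  have e : (t * √(N : ℝ) * (x - mPlus β) * Complex.I : ℂ) =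
      ((t * √(N : ℝ) * (x - mPlus β) : ℝ) : ℂ) * Complex.I := by push_cast; ring
  rw [e, norm_mul, Complex.norm_exp_ofReal_mul_I, mul_one, Complex.norm_real, Real.norm_eq_abs,
    abs_of_pos (Real.exp_pos _)]

theorem integrable_spinMode {β : ℝ} (hβ : 0 < β) (t : ℝ) {N : ℕ} (hN : 0 < N) (σ : Config N) :
    Integrable (spinMode β t σ) := by
  refine (integrable_exp_mul_spin hβ hN (totalSpin σ)).mono'
    (Continuous.aestronglyMeasurable ?_) (ae_of_all _ fun x => (norm_spinMode β t σ x).le)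
  unfold spinMode
  fun_prop

/-- Given `σ`, `√N (x - m)` is Gaussian with mean `fluctuation β σ` and variance `1 / β`, so the
mode of the fluctuation appears with the factor `exp (-t² / (2 β))`. -/
theorem integral_spinMode {β : ℝ} (hβ : 0 < β) (t : ℝ) {N : ℕ} (hN : 0 < N) (σ : Config N) :
    ∫ x, spinMode β t σ x = √(2 * Real.pi / (N * β)) * Real.exp (-(t ^ 2 / (2 * β))) *
      (curieWeissWeight β σ * Complex.exp (t * fluctuation β σ * Complex.I)) := by
  have hN' : (0 : ℝ) < N := by exact_mod_cast hN
  have hs : √(N : ℝ) ≠ 0 := (Real.sqrt_pos.2 hN').ne'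
  have h := integral_cexp_mul_spin hβ hN (totalSpin σ) (t * √(N : ℝ))
  have e : ∀ x, spinMode β t σ x = Complex.exp (-(N * β / 2) * x ^ 2 +
      (β * totalSpin σ + (t * √(N : ℝ) : ℝ) * Complex.I) * x) *
      Complex.exp (-(t * √(N : ℝ) * mPlus β * Complex.I)) := by
    intro x
    unfold spinMode
    push_cast
    rw [← Complex.exp_add, ← Complex.exp_add]
    congr 1
    ring
  simp_rw [e]
  rw [integral_mul_const, h]
  have e1 : (t * √(N : ℝ)) ^ 2 / (2 * (N * β)) = t ^ 2 / (2 * β) := by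
    rw [mul_pow, Real.sq_sqrt hN'.le]
    field_simp
  have e2 : Complex.exp (t * fluctuation β σ * Complex.I) =
      Complex.exp ((t * √(N : ℝ) : ℝ) * (totalSpin σ / N) * Complex.I) *
        Complex.exp (-(t * √(N : ℝ) * mPlus β * Complex.I)) := by
    rw [← Complex.exp_add]
    congr 1
    have h1 : fluctuation β σ = √(N : ℝ) * (totalSpin σ / N) - √(N : ℝ) * mPlus β := by
      unfold fluctuation
      rw [div_eq_iff hs]
      have := Real.mul_self_sqrt hN'.le
      have h2 : (√(N : ℝ) * (totalSpin σ / N) - √(N : ℝ) * mPlus β) * √(N : ℝ) =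
        (√(N : ℝ) * √(N : ℝ)) * (totalSpin σ / N - mPlus β) := by ring
      rw [h2, this]
      field_simp
    rw [h1]
    push_cast
    ring
  rw [e1, e2]
  unfold curieWeissWeight
  ring

/-- Where `x` and the magnetization have opposite signs the linear term does not help, and the
integrand stays below the pure Gaussian. -/
theorem norm_setIntegral_spinMode_le {β : ℝ} (hβ : 0 < β) (t : ℝ) {N : ℕ} (hN : 0 < N)
    (σ : Config N) {s : Set ℝ} (hs : MeasurableSet s) (h : ∀ x ∈ s, totalSpin σ * x ≤ 0) :
    ‖∫ x in s, spinMode β t σ x‖ ≤ √(2 * Real.pi / (N * β)) := by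
  have hN' : (0 : ℝ) < N := by exact_mod_cast hN
  have hi := integrable_exp_neg_mul_sq (show 0 < N * β / 2 by positivity)
  have e : 2 * Real.pi / (N * β) = Real.pi / (N * β / 2) := by field_simp
  rw [e, ← integral_gaussian]
  refine (norm_integral_le_of_norm_le hi.integrableOn
    ((ae_restrict_iff' hs).2 (ae_of_all _ fun x hx => ?_))).trans
    (setIntegral_le_integral hi (ae_of_all _ fun x => (Real.exp_pos _).le))
  rw [norm_spinMode]
  refine Real.exp_le_exp.2 ?_
  have := mul_le_mul_of_nonneg_left (h x hx) hβ.le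
  linarith

theorem sum_setIntegral_spinMode {β : ℝ} (hβ : 0 < β) (t : ℝ) {N : ℕ} (hN : 0 < N) :
    ∑ σ : Config N, ∫ x in Set.Ioi 0, spinMode β t σ x = 2 ^ N * laplaceIntegral β t N := by
  rw [← integral_finsetSum _ fun σ _ => (integrable_spinMode hβ t hN σ).integrableOn]
  unfold laplaceIntegral
  rw [← integral_const_mul]
  congr 1
  ext x
  unfold spinMode
  rw [← Finset.sum_mul, ← mul_assoc, ← Complex.ofReal_sum]
  congr 1
  have h := exp_mul_cosh_pow β x N
  rw [← sum_exp_mul_totalSpin, Finset.mul_sum] at h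
  have e : ∀ σ : Config N, Real.exp (-(N * β / 2) * x ^ 2 + β * totalSpin σ * x) =
      Real.exp (-(N * β / 2) * x ^ 2) * Real.exp (β * x * totalSpin σ) := by
    intro σ
    rw [← Real.exp_add]
    congr 1
    ring
  simp_rw [e, h]
  push_cast
  rfl

/-- Up to an error of lower order, the Fourier modes of the positively magnetized phase are given
by a Laplace integral over the half line. -/
theorem norm_sum_fourier_sub_le {β : ℝ} (hβ : 0 < β) (t : ℝ) {N : ℕ} (hN : 0 < N) :
    ‖√(2 * Real.pi / (N * β)) * Real.exp (-(t ^ 2 / (2 * β))) *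
        (∑ σ : Config N with 0 < totalSpin σ,
          (curieWeissWeight β σ : ℂ) * Complex.exp (t * fluctuation β σ * Complex.I)) -
        2 ^ N * laplaceIntegral β t N‖ ≤ 2 ^ N * √(2 * Real.pi / (N * β)) := by
  rw [Finset.mul_sum, ← sum_setIntegral_spinMode hβ t hN, Finset.sum_filter,
    ← Finset.sum_sub_distrib]
  have hcard : (2 : ℝ) ^ N * √(2 * Real.pi / (N * β)) =
      ∑ _σ : Config N, √(2 * Real.pi / (N * β)) := by
    simp
  rw [hcard]
  refine norm_sum_le_of_le _ fun σ _ => ?_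
  -- A configuration with positive magnetization errs by its integral over `x ≤ 0`, any other one by
  -- its integral over `x > 0`: the half line of opposite sign in either case.
  by_cases hσ : 0 < totalSpin σ
  · rw [if_pos hσ, ← integral_spinMode hβ t hN]
    have hi := integrable_spinMode hβ t hN σ
    rw [← intervalIntegral.integral_Iic_add_Ioi (b := 0) hi.integrableOn hi.integrableOn,
      add_sub_cancel_right]
    exact norm_setIntegral_spinMode_le hβ t hN σ measurableSet_Iic fun x hx =>
      mul_nonpos_of_nonneg_of_nonpos hσ.le hx
  · rw [if_neg hσ, zero_sub, norm_neg]
    exact norm_setIntegral_spinMode_le hβ t hN σ measurableSet_Ioi fun x hx =>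
      mul_nonpos_of_nonpos_of_nonneg (not_lt.1 hσ) (le_of_lt hx)

theorem tendsto_laplaceIntegral_div {β : ℝ} (hβ : 1 < β) (t : ℝ) :
    Tendsto (fun N : ℕ => laplaceIntegral β t N / (2 * laplaceIntegral β 0 N)) atTop
      (𝓝 ((Real.exp (-(t ^ 2 / (2 * curvature β))) : ℂ) / 2)) := by
  have hcurv := curvature_pos hβ
  have hne : (√(2 * Real.pi / curvature β) : ℂ) ≠ 0 := by
    have : 0 < √(2 * Real.pi / curvature β) := by
      have := Real.pi_pos
      positivity
    exact_mod_cast this.ne'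
  have h0 := (tendsto_laplaceIntegral hβ 0).const_mul 2
  have h1 := (tendsto_laplaceIntegral hβ t).div h0 (by simpa using hne)
  have e : (√(2 * Real.pi / curvature β) * Real.exp (-(t ^ 2 / (2 * curvature β))) : ℂ) /
      (2 * (√(2 * Real.pi / curvature β) * Real.exp (-(0 ^ 2 / (2 * curvature β))))) =
      (Real.exp (-(t ^ 2 / (2 * curvature β))) : ℂ) / 2 := by
    simp
    field_simp
  rw [e] at h1
  refine h1.congr' ?_
  filter_upwards [eventually_gt_atTop 0] with N hN
  have hs : (√(N : ℝ) : ℂ) ≠ 0 := by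
    have : 0 < √(N : ℝ) := Real.sqrt_pos.2 (by exact_mod_cast hN)
    exact_mod_cast this.ne'
  have hx : (Real.exp (-(N * pressure β (mPlus β))) : ℂ) ≠ 0 := by
    exact_mod_cast (Real.exp_pos _).ne'
  simp only [Pi.div_apply]
  rw [mul_left_comm 2, mul_div_mul_left _ _ (mul_ne_zero hs hx)]

/-- Convergence of the characteristic functions of the magnetization in the positive phase of the
Curie–Weiss model. -/
theorem tendsto_sum_fourier {β : ℝ} (hβ : 1 < β) (t : ℝ) :
    Tendsto (fun N : ℕ => (∑ σ : Config N with 0 < totalSpin σ,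
          (curieWeissWeight β σ : ℂ) * Complex.exp (t * fluctuation β σ * Complex.I)) /
        ((∑ σ : Config N, curieWeissWeight β σ : ℝ) : ℂ)) atTop
      (𝓝 ((Real.exp (-(variance β * t ^ 2 / 2)) : ℂ) / 2)) := by
  have hβ0 : 0 < β := by linarith
  have hdiff : Tendsto (fun N : ℕ => (Real.exp (-(t ^ 2 / (2 * β))) : ℂ) *
      ((∑ σ : Config N with 0 < totalSpin σ,
          (curieWeissWeight β σ : ℂ) * Complex.exp (t * fluctuation β σ * Complex.I)) /
        ((∑ σ : Config N, curieWeissWeight β σ : ℝ) : ℂ)) -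
      laplaceIntegral β t N / (2 * laplaceIntegral β 0 N)) atTop (𝓝 0) := by
    refine squeeze_zero_norm' ?_ (tendsto_exp_neg_mul_pressure hβ)
    filter_upwards [eventually_gt_atTop 0] with N hN
    have hN' : (0 : ℝ) < N := by exact_mod_cast hN
    refine le_trans ?_ (two_pow_div_sum_curieWeissWeight_le hβ hN)
    have hU := sum_curieWeissWeight_pos β N
    have hK : 0 < √(2 * Real.pi / (N * β)) := by
      have := Real.pi_pos
      positivity
    have h1 := sum_curieWeissWeight hβ0 hN
    have h2 := norm_sum_fourier_sub_le hβ0 t hN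
    set K := √(2 * Real.pi / (N * β))
    set U := ∑ σ : Config N, curieWeissWeight β σ
    have hUC : (U : ℂ) ≠ 0 := by exact_mod_cast hU.ne'
    have hKC : (K : ℂ) ≠ 0 := by exact_mod_cast hK.ne'
    have h3 : (K : ℂ) * U = 2 ^ N * (2 * laplaceIntegral β 0 N) := by
      rw [← integral_exp_pressure hβ hN]
      exact_mod_cast h1
    have h4 : 2 * laplaceIntegral β 0 N = (K : ℂ) * U / 2 ^ N := by
      rw [h3]; field_simp
    rw [h4]
    set A := ∑ σ : Config N with 0 < totalSpin σ,
          (curieWeissWeight β σ : ℂ) * Complex.exp (t * fluctuation β σ * Complex.I)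
    have e : (Real.exp (-(t ^ 2 / (2 * β))) : ℂ) * (A / U) -
        laplaceIntegral β t N / ((K : ℂ) * U / 2 ^ N) =
        (K * Real.exp (-(t ^ 2 / (2 * β))) * A - 2 ^ N * laplaceIntegral β t N) /
          ((K * U : ℝ) : ℂ) := by
      push_cast
      field_simp
    rw [e, norm_div, Complex.norm_real, Real.norm_eq_abs, abs_of_pos (mul_pos hK hU),
      div_le_div_iff₀ (mul_pos hK hU) hU]
    calc _ ≤ 2 ^ N * K * U := mul_le_mul_of_nonneg_right h2 hU.le
      _ = _ := by ring
  -- Multiplication by `exp (t² / (2 β))` removes the Gaussian noise added by the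
  -- Hubbard–Stratonovich transformation.
  have h := (hdiff.add (tendsto_laplaceIntegral_div hβ t)).const_mul
    (Real.exp (t ^ 2 / (2 * β)) : ℂ)
  have e : (Real.exp (t ^ 2 / (2 * β)) : ℂ) *
      (0 + (Real.exp (-(t ^ 2 / (2 * curvature β))) : ℂ) / 2) =
      (Real.exp (-(variance β * t ^ 2 / 2)) : ℂ) / 2 := by
    rw [zero_add, ← mul_div_assoc, ← Complex.ofReal_mul, ← Real.exp_add, variance_eq hβ]
    congr 3
    ring
  rw [e] at h
  refine h.congr fun N => ?_
  rw [sub_add_cancel, ← mul_assoc, ← Complex.ofReal_mul, ← Real.exp_add, add_neg_cancel]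
  simp

/-! ### Central limit theorem in the two Curie–Weiss phases -/

theorem exists_totalSpin_pos {N : ℕ} (hN : 0 < N) :
    (Finset.univ.filter fun σ : Config N => 0 < totalSpin σ).Nonempty :=
  ⟨1, Finset.mem_filter.2 ⟨Finset.mem_univ _, by simp [totalSpin, spin, hN]⟩⟩

/-- The law of the fluctuation in the positively magnetized phase of the Curie–Weiss model. -/
def phaseLaw (β : ℝ) (N : ℕ) : Measure ℝ :=
  ∑ σ : Config N with 0 < totalSpin σ,
    ENNReal.ofReal (curieWeissWeight β σ /
      ∑ τ : Config N with 0 < totalSpin τ, curieWeissWeight β τ) •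
      Measure.dirac (fluctuation β σ)

theorem sum_phase_pos (β : ℝ) {N : ℕ} (hN : 0 < N) :
    0 < ∑ σ : Config N with 0 < totalSpin σ, curieWeissWeight β σ :=
  Finset.sum_pos (fun σ _ => curieWeissWeight_pos β σ) (exists_totalSpin_pos hN)

theorem isProbabilityMeasure_phaseLaw (β : ℝ) {N : ℕ} (hN : 0 < N) :
    IsProbabilityMeasure (phaseLaw β N) := by
  constructor
  have hpos := sum_phase_pos β hN
  unfold phaseLaw
  simp only [Measure.coe_finsetSum, Measure.smul_apply, Finset.sum_apply, measure_univ,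
    smul_eq_mul, mul_one]
  rw [← ENNReal.ofReal_sum_of_nonneg fun σ _ =>
    div_nonneg (curieWeissWeight_pos β σ).le hpos.le, ← Finset.sum_div, div_self hpos.ne',
    ENNReal.ofReal_one]

theorem integral_phaseLaw {E : Type*} [NormedAddCommGroup E] [NormedSpace ℝ E] [CompleteSpace E]
    (β : ℝ) (N : ℕ) (f : ℝ → E) : ∫ x, f x ∂phaseLaw β N =
      ∑ σ : Config N with 0 < totalSpin σ, (curieWeissWeight β σ /
        ∑ τ : Config N with 0 < totalSpin τ, curieWeissWeight β τ) • f (fluctuation β σ) := by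
  unfold phaseLaw
  rw [integral_finsetSum_measure fun σ _ => (integrable_dirac (by simp)).smul_measure (by simp)]
  refine Finset.sum_congr rfl fun σ _ => ?_
  rw [integral_smul_measure, integral_dirac, ENNReal.toReal_ofReal]
  exact div_nonneg (curieWeissWeight_pos β σ).le
    (Finset.sum_nonneg fun τ _ => (curieWeissWeight_pos β τ).le)

/-- The mass of the phase is its Fourier mode at `t = 0`. -/
theorem tendsto_phase_mass {β : ℝ} (hβ : 1 < β) :
    Tendsto (fun N : ℕ => (∑ σ : Config N with 0 < totalSpin σ, curieWeissWeight β σ) /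
      ∑ σ : Config N, curieWeissWeight β σ) atTop (𝓝 (1 / 2)) := by
  have h := (Complex.continuous_re.tendsto _).comp (tendsto_sum_fourier hβ 0)
  refine (h.congr fun N => ?_).trans (le_of_eq ?_)
  · simp only [Function.comp, Complex.ofReal_zero, zero_mul, Complex.exp_zero, mul_one]
    rw [← Complex.ofReal_sum, ← Complex.ofReal_div, Complex.ofReal_re]
  · simp

/-- The central limit theorem for the positively magnetized phase of the Curie–Weiss model. -/
theorem tendsto_sum_phase {β : ℝ} (hβ : 1 < β) (g : BoundedContinuousFunction ℝ ℝ) :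
    Tendsto (fun N : ℕ => (∑ σ : Config N with 0 < totalSpin σ,
        curieWeissWeight β σ * g (fluctuation β σ)) / ∑ σ : Config N, curieWeissWeight β σ) atTop
      (𝓝 (1 / 2 * ∫ x, g x ∂gaussianReal 0 (variance β).toNNReal)) := by
  -- The index starts at `1` because for `N = 0` no configuration has positive magnetization and
  -- `phaseLaw β 0` is the zero measure.
  let μ : ℕ → ProbabilityMeasure ℝ := fun n =>
    ⟨phaseLaw β (n + 1), isProbabilityMeasure_phaseLaw β n.succ_pos⟩
  let μ₀ : ProbabilityMeasure ℝ := ⟨gaussianReal 0 (variance β).toNNReal, inferInstance⟩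
  have hμ : Tendsto μ atTop (𝓝 μ₀) := by
    refine ProbabilityMeasure.tendsto_of_tendsto_charFun fun t => ?_
    have h1 := (tendsto_sum_fourier hβ t).div
      ((Complex.continuous_ofReal.tendsto _).comp (tendsto_phase_mass hβ)) (by simp)
    have h2 := (tendsto_add_atTop_iff_nat 1).2 h1
    have e : charFun (μ₀ : Measure ℝ) t =
        (Real.exp (-(variance β * t ^ 2 / 2)) : ℂ) / 2 / ((1 / 2 : ℝ) : ℂ) := by
      change charFun (gaussianReal 0 (variance β).toNNReal) t = _
      rw [charFun_gaussianReal]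
      have : (((variance β).toNNReal : ℝ) : ℂ) = variance β := by
        rw [Real.coe_toNNReal _ (variance_pos hβ).le]
      rw [this]
      push_cast
      simp
    rw [e]
    refine h2.congr fun n => ?_
    change _ = charFun (phaseLaw β (n + 1)) t
    rw [charFun_apply_real, integral_phaseLaw]
    simp only [Pi.div_apply, Function.comp, Complex.ofReal_div]
    have hU : ((∑ σ : Config (n + 1), curieWeissWeight β σ : ℝ) : ℂ) ≠ 0 := by
      exact_mod_cast (sum_curieWeissWeight_pos β (n + 1)).ne'
    rw [div_div_div_cancel_right₀ hU, Finset.sum_div]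
    refine Finset.sum_congr rfl fun σ _ => ?_
    rw [Complex.real_smul]
    push_cast
    ring
  have h1 := (ProbabilityMeasure.tendsto_iff_forall_integral_tendsto.1 hμ) g
  have h2 := ((tendsto_add_atTop_iff_nat 1).2 (tendsto_phase_mass hβ)).mul h1
  rw [← tendsto_add_atTop_iff_nat 1]
  refine h2.congr fun n => ?_
  change _ * ∫ x, g x ∂phaseLaw β (n + 1) = _
  rw [integral_phaseLaw, Finset.mul_sum]
  conv_rhs => rw [Finset.sum_div]
  refine Finset.sum_congr rfl fun σ _ => ?_
  have := (sum_phase_pos β n.succ_pos).ne'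
  rw [smul_eq_mul]
  field_simp

theorem totalSpin_neg {N : ℕ} (σ : Config N) : totalSpin (-σ) = -totalSpin σ := by
  simp [totalSpin, spin]

/-- Configurations of zero magnetization have weight `1`, and there are at most `2 ^ N` of them,
exponentially few compared with the partition function. -/
theorem tendsto_sum_totalSpin_eq_zero {β : ℝ} (hβ : 1 < β) :
    Tendsto (fun N : ℕ => (∑ σ : Config N with totalSpin σ = 0, curieWeissWeight β σ) /
      ∑ σ : Config N, curieWeissWeight β σ) atTop (𝓝 0) := by
  refine squeeze_zero' (Eventually.of_forall fun N => div_nonneg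
    (Finset.sum_nonneg fun σ _ => (curieWeissWeight_pos β σ).le)
    (sum_curieWeissWeight_pos β N).le) ?_ (tendsto_exp_neg_mul_pressure hβ)
  filter_upwards [eventually_gt_atTop 0] with N hN
  refine le_trans ?_ (two_pow_div_sum_curieWeissWeight_le hβ hN)
  refine div_le_div_of_nonneg_right ?_ (sum_curieWeissWeight_pos β N).le
  have h1 : ∀ σ ∈ (Finset.univ : Finset (Config N)).filter fun σ => totalSpin σ = 0,
      curieWeissWeight β σ = 1 := by
    intro σ hσ
    simp [curieWeissWeight, (Finset.mem_filter.1 hσ).2]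
  rw [Finset.sum_congr rfl h1]
  have h2 := Finset.card_filter_le (Finset.univ : Finset (Config N)) fun σ => totalSpin σ = 0
  have h3 : (Finset.univ : Finset (Config N)).card = 2 ^ N := by simp
  rw [h3] at h2
  simp only [Finset.sum_const, nsmul_eq_mul, mul_one]
  exact_mod_cast h2

/-- The central limit theorem for the negatively magnetized phase of the Curie–Weiss model. -/
theorem tendsto_sum_phase_neg {β : ℝ} (hβ : 1 < β) (g : BoundedContinuousFunction ℝ ℝ) :
    Tendsto (fun N : ℕ => (∑ σ : Config N with totalSpin σ ≤ 0,
        curieWeissWeight β σ * g ((totalSpin σ - N * mMinus β) / √(N : ℝ))) /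
          ∑ σ : Config N, curieWeissWeight β σ) atTop
      (𝓝 (1 / 2 * ∫ x, g x ∂gaussianReal 0 (variance β).toNNReal)) := by
  let g' : BoundedContinuousFunction ℝ ℝ := g.compContinuous ⟨fun x => -x, continuous_neg⟩
  have hg' : ∀ x, g' x = g (-x) := fun x => rfl
  have h1 := tendsto_sum_phase hβ g'
  have hint : ∫ x, g' x ∂gaussianReal 0 (variance β).toNNReal =
      ∫ x, g x ∂gaussianReal 0 (variance β).toNNReal := by
    have h := gaussianReal_map_neg (μ := 0) (v := (variance β).toNNReal)
    rw [neg_zero] at h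
    conv_rhs => rw [← h]
    rw [integral_map (by fun_prop) g.continuous.aestronglyMeasurable]
    rfl
  rw [hint] at h1
  have h0 : Tendsto (fun N : ℕ => (∑ σ : Config N with totalSpin σ = 0,
        curieWeissWeight β σ * g' (fluctuation β σ)) / ∑ σ : Config N, curieWeissWeight β σ)
      atTop (𝓝 0) := by
    have h := (tendsto_sum_totalSpin_eq_zero hβ).const_mul ‖g'‖
    rw [mul_zero] at h
    refine squeeze_zero_norm (fun N => ?_) h
    rw [norm_div, Real.norm_of_nonneg (sum_curieWeissWeight_pos β N).le, ← mul_div_assoc,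
      Finset.mul_sum]
    refine div_le_div_of_nonneg_right ?_ (sum_curieWeissWeight_pos β N).le
    refine norm_sum_le_of_le _ fun σ _ => ?_
    rw [norm_mul, Real.norm_of_nonneg (curieWeissWeight_pos β σ).le, mul_comm]
    exact mul_le_mul_of_nonneg_right (g'.norm_coe_le_norm _) (curieWeissWeight_pos β σ).le
  have h := h1.add h0
  rw [add_zero] at h
  refine h.congr fun N => ?_
  rw [← add_div]
  congr 1
  -- The spin flip maps `M ≤ 0` onto `M ≥ 0`, that is, the positive phase together with the
  -- negligible layer `M = 0`.
  rw [Finset.sum_filter, Finset.sum_filter, Finset.sum_filter, ← Finset.sum_add_distrib,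
    ← Equiv.sum_comp (Equiv.neg (Config N))]
  refine Finset.sum_congr rfl fun σ _ => ?_
  simp only [Equiv.neg_apply, totalSpin_neg, fluctuation, hg']
  have e : -((-totalSpin σ - N * mPlus β) / √(N : ℝ)) =
      (totalSpin σ - N * mMinus β) / √(N : ℝ) := by
    unfold mMinus; ring
  have e2 : curieWeissWeight β (-σ) = curieWeissWeight β σ := by
    simp [curieWeissWeight, totalSpin_neg]
  rw [e, e2]
  rcases lt_trichotomy (totalSpin σ) 0 with h | h | h
  · simp [h, h.le, h.ne]
  · simp [h]
  · simp [h.not_ge, h.ne', not_lt.2 h.le]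

/-! ### Transfer to the diluted model -/

theorem integral_sum_smul_diracFM {N : ℕ} (S : Finset (Config N)) (w : Config N → ℝ)
    (hw : ∀ σ, 0 ≤ w σ) (x : Config N → ℝ) (g : ℝ → ℝ) :
    ∫ y, g y ∂((∑ σ ∈ S, (w σ).toNNReal • diracFM (x σ) : FiniteMeasure ℝ) : Measure ℝ) =
      ∑ σ ∈ S, w σ * g (x σ) := by
  rw [FiniteMeasure.toMeasure_sum]
  have e : ∀ σ, (((w σ).toNNReal • diracFM (x σ) : FiniteMeasure ℝ) : Measure ℝ) =
      (w σ).toNNReal • Measure.dirac (x σ) := fun σ => rfl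
  simp_rw [e]
  rw [integral_finsetSum_measure fun σ _ => (integrable_dirac (by simp)).smul_measure_nnreal]
  refine Finset.sum_congr rfl fun σ _ => ?_
  rw [integral_smul_nnreal_measure, integral_dirac, NNReal.smul_def, smul_eq_mul,
    Real.coe_toNNReal _ (hw σ)]

/-- Since `q √N = √(q² N)` and `q ≤ 1`, it suffices that `q² N ≥ q³ N` diverges. -/
theorem tendsto_errorRate (β : ℝ) {p : ℕ → ℝ} (hp : ∀ N, 0 < p N ∧ p N ≤ 1)
    (hpN : Tendsto (fun N : ℕ => p N ^ 3 * (N : ℝ)) atTop atTop) :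
    Tendsto (fun N => errorRate β (p N) N) atTop (𝓝 0) := by
  unfold errorRate
  refine tendsto_const_nhds.div_atTop ?_
  have h2 : Tendsto (fun N : ℕ => p N ^ 2 * (N : ℝ)) atTop atTop :=
    tendsto_atTop_mono (fun N => mul_le_mul_of_nonneg_right
      (pow_le_pow_of_le_one (hp N).1.le (hp N).2 (by norm_num)) N.cast_nonneg) hpN
  refine (Real.tendsto_sqrt_atTop.comp h2).congr fun N => ?_
  simp only [Function.comp]
  rw [Real.sqrt_mul (sq_nonneg _), Real.sqrt_sq (hp N).1.le]

theorem gibbs_nonneg (β q : ℝ) {N : ℕ} (e : Fin N → Fin N → ℝ) (σ : Config N) :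
    0 ≤ gibbs β q 0 e σ :=
  div_nonneg (Real.exp_pos _).le (Finset.sum_nonneg fun _ _ => (Real.exp_pos _).le)

/-- A limit theorem for a phase of the Curie–Weiss model carries over in probability to the diluted
model. -/
theorem convergesInProbability_of_curieWeiss {β : ℝ} (hβ : 1 < β)
    {p : ℕ → ℝ} (hp : ∀ N, 0 < p N ∧ p N ≤ 1)
    (hpN : Tendsto (fun N : ℕ => p N ^ 3 * (N : ℝ)) atTop atTop)
    {Ω : ℕ → Type*} [∀ N, MeasurableSpace (Ω N)]
    {P : ∀ N, Measure (Ω N)} [∀ N, IsProbabilityMeasure (P N)]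
    {ε : ∀ N, Fin N → Fin N → Ω N → ℝ}
    (hε : ∀ N, IsDirectedErdosRenyi (P N) (p N) (ε N))
    {ρ : MetricSpace (FiniteMeasure ℝ)} (hρ : GeneratesWeakTopology ρ)
    (S : ∀ N, Finset (Config N)) (x : ∀ N, Config N → ℝ) (ν : FiniteMeasure ℝ)
    (hlim : ∀ g : BoundedContinuousFunction ℝ ℝ, Tendsto (fun N : ℕ =>
      (∑ σ ∈ S N, curieWeissWeight β σ * g (x N σ)) / ∑ σ : Config N, curieWeissWeight β σ) atTop
      (𝓝 (1 / 2 * ∫ y, g y ∂(ν : Measure ℝ)))) :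
    ConvergesInProbability ρ P (fun N ω => ∑ σ ∈ S N,
      (2 * gibbs β (p N) 0 (fun i j => ε N i j ω) σ).toNNReal • diracFM (x N σ)) ν := by
  classical
  refine convergesInProbability_of_forall_integral hρ fun g η hη => ?_
  obtain ⟨C, hC, hmom⟩ := exists_moments_le hβ
  set B := 1 + ‖g‖ with hB_def
  have hB : 1 ≤ B := by linarith [norm_nonneg g]
  -- The threshold `2 (1 + B) η' ≤ η / 4` and the Curie–Weiss error `η / 8`, each doubled by the
  -- factor `2` in the measure, add up to `3 η / 4 < η`.
  set η' := min (1 / 2) (η / (8 * (1 + B))) with hη'_def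
  have hη' : 0 < η' := by positivity
  have hη'1 : η' ≤ 1 / 2 := min_le_left _ _
  have hη'2 : 2 * (1 + B) * η' ≤ η / 4 := by
    have h := min_le_right (1 / 2) (η / (8 * (1 + B)))
    rw [← hη'_def, le_div_iff₀ (by positivity)] at h
    linarith
  set a := ∫ y, g y ∂(ν : Measure ℝ)
  have herr := tendsto_errorRate β hp hpN
  have hbound : Tendsto (fun N => ENNReal.ofReal
      (6 * B ^ 2 * (C * errorRate β (p N) N) / η' ^ 2)) atTop (𝓝 0) := by
    have h := (((herr.const_mul C).const_mul (6 * B ^ 2)).div_const (η' ^ 2))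
    rw [mul_zero, mul_zero, zero_div] at h
    simpa using ENNReal.tendsto_ofReal h
  refine tendsto_of_tendsto_of_tendsto_of_le_of_le' tendsto_const_nhds hbound
    (Eventually.of_forall fun _ => zero_le) ?_
  filter_upwards [hmom, herr.eventually (eventually_le_nhds one_pos),
    (Metric.tendsto_nhds.1 (hlim g)) (η / 8) (by positivity)] with N hmom hsmall hclose
  obtain ⟨h1, h2⟩ := hmom (p N) (hp N).1 (hp N).2 hsmall (P N) (ε N) (hε N)
  -- Extension by zero outside the phase lets numerator and denominator run over all configurations,
  -- as the ratio estimate requires.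
  set G : Config N → ℝ := fun σ => if σ ∈ S N then g (x N σ) else 0 with hG
  have hGB : ∀ σ, |G σ| ≤ B := by
    intro σ
    simp only [hG]
    split_ifs
    · have := g.norm_coe_le_norm (x N σ)
      rw [Real.norm_eq_abs] at this
      linarith
    · simpa using zero_le_one.trans hB
  have hprob := prob_weightedMean_le (P N)
    (fun σ ω => centeredWeight β (p N) (fun i j => ε N i j ω) σ)
    (fun σ => (hε N).memLp_exp_sum (hp N).1.le (hp N).2 _) (curieWeissWeight β)
    (weightFactor β (p N) N) _ B (Real.exp_pos _) (fun σ => (curieWeissWeight_pos β σ).le)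
    (sum_curieWeissWeight_pos β N) h1 h2 G hB hGB η' hη' hη'1
  refine (measure_mono fun ω hω => ?_).trans hprob
  simp only [Set.mem_ofPred_eq] at hω ⊢
  rw [integral_sum_smul_diracFM _ _ (fun σ => mul_nonneg zero_le_two (gibbs_nonneg _ _ _ σ))] at hω
  have hu : ∑ σ, curieWeissWeight β σ * G σ = ∑ σ ∈ S N, curieWeissWeight β σ * g (x N σ) := by
    simp [hG, mul_ite, Finset.sum_ite_mem]
  have hW : ∑ σ ∈ S N, 2 * gibbs β (p N) 0 (fun i j => ε N i j ω) σ * g (x N σ) =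
      2 * ((∑ σ, centeredWeight β (p N) (fun i j => ε N i j ω) σ * G σ) /
        ∑ σ, centeredWeight β (p N) (fun i j => ε N i j ω) σ) := by
    have : ∑ σ, centeredWeight β (p N) (fun i j => ε N i j ω) σ * G σ =
        ∑ σ ∈ S N, centeredWeight β (p N) (fun i j => ε N i j ω) σ * g (x N σ) := by
      simp [hG, mul_ite, Finset.sum_ite_mem]
    rw [this, Finset.sum_div, Finset.mul_sum]
    refine Finset.sum_congr rfl fun σ _ => ?_
    rw [gibbs_eq]
    ring
  rw [hW] at hω
  rw [hu]
  rw [Real.dist_eq] at hclose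
  set X := (∑ σ, centeredWeight β (p N) (fun i j => ε N i j ω) σ * G σ) /
        ∑ σ, centeredWeight β (p N) (fun i j => ε N i j ω) σ
  set Y := (∑ σ ∈ S N, curieWeissWeight β σ * g (x N σ)) / ∑ σ : Config N, curieWeissWeight β σ
  have h3 : |2 * X - a| ≤ 2 * |X - Y| + 2 * |Y - 1 / 2 * a| := by
    have e : 2 * X - a = 2 * (X - Y) + 2 * (Y - 1 / 2 * a) := by ring
    rw [e]
    refine (abs_add_le _ _).trans (le_of_eq ?_)
    rw [abs_mul, abs_mul, abs_of_pos (two_pos : (0 : ℝ) < 2)]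
  have h4 : η ≤ |2 * X - a| := hω
  linarith

end

end DiluteCurieWeiss

theorem theorem1p1 (β : ℝ) (hβ : 1 < β)
    (p : ℕ → ℝ) (hp : ∀ N, 0 < p N ∧ p N ≤ 1)
    (hpN : Filter.Tendsto (fun N : ℕ => p N ^ 3 * (N : ℝ)) Filter.atTop Filter.atTop)
    {Ω : ℕ → Type*} [∀ N, MeasurableSpace (Ω N)]
    (P : ∀ N, MeasureTheory.Measure (Ω N)) [∀ N, MeasureTheory.IsProbabilityMeasure (P N)]
    (ε : ∀ N, Fin N → Fin N → Ω N → ℝ)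
    (hε : ∀ N, DiluteCurieWeiss.IsDirectedErdosRenyi (P N) (p N) (ε N))
    (ρ : MetricSpace (MeasureTheory.FiniteMeasure ℝ))
    (hρ : DiluteCurieWeiss.GeneratesWeakTopology ρ) :
    DiluteCurieWeiss.ConvergesInProbability ρ P
        (fun N ω => DiluteCurieWeiss.LPlus β (p N) (fun i j => ε N i j ω))
        (DiluteCurieWeiss.normalFM (DiluteCurieWeiss.variance β)) ∧
      DiluteCurieWeiss.ConvergesInProbability ρ P
        (fun N ω => DiluteCurieWeiss.LMinus β (p N) (fun i j => ε N i j ω))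
        (DiluteCurieWeiss.normalFM (DiluteCurieWeiss.variance β)) :=
  ⟨DiluteCurieWeiss.convergesInProbability_of_curieWeiss hβ hp hpN hε hρ _ _ _
      (DiluteCurieWeiss.tendsto_sum_phase hβ),
    DiluteCurieWeiss.convergesInProbability_of_curieWeiss hβ hp hpN hε hρ _ _ _
      (DiluteCurieWeiss.tendsto_sum_phase_neg hβ)⟩
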